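/- **Theorem (TV indistinguishability implies replicability).** Let $\mathcal X$ be a measurable space, let $\{0,1\}^{\mathcal X}$ carry a $\sigma$-algebra, let $n\ge 0$ and $\rho\ge 0$, and let $\mathcal P$ be a probability measure on $\{0,1\}^{\mathcal X}$. A *learning rule* $A$ assigns to every sample $S\in(\mathcal X\times\{0,1\})^n$ a probability measure $A(S)$ on $\{0,1\}^{\mathcal X}$. Suppose that for every probability distribution $\mathcal D$ on $\mathcal X\times\{0,1\}$ * $A$ is $n$-sample $\rho$-TV indistinguishable: $\mathbf E_{S,S'\sim\mathcal D^n}\big[d_{\mathrm{TV}}(A(S),A(S'))\big]\le\rho$ for independent $S,S'$, where $d_{\mathrm{TV}}(P,Q)=\sup_B (P(B)-Q(B))$ over measurable $B$; * $A$ is absolutely continuous with respect to $\mathcal P$: $A(S)\ll\mathcal P$ for $\mathcal D^n$-almost every $S$. Then there are a distribution $\mathcal R$ of random sequences $r=(h_i,y_i,t_i)_{i\in\mathbb N}$ in $\{0,1\}^{\mathcal X}\times\mathbb R\times\mathbb R$ that form a Poisson point process with intensity $\mathcal P\times\mathrm{Leb}\times\mathrm{Leb}$ ($\mathrm{Leb}$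 is Lebesgue measure on $\mathbb R_+$), and a map $(S,r)\mapsto A'(S,r)\in\{0,1\}^{\mathcal X}$, such that: 1. (equivalence) for every sample $S$, the random variable $A'(S,r)$, $r\sim\mathcal R$, has distribution $A(S)$; 2. (rejection sampling) for every sample $S$, with $f_S=dA(S)/d\mathcal P$, almost surely there is a unique point with minimal $t_j$ among the points with $y_j<f_S(h_j)$, and $A'(S,r)=h_j$; 3. (replicability) $A'$ is $n$-sample $\frac{2\rho}{1+\rho}$-replicable: for every distribution $\mathcal D$ on $\mathcal X\times\{0,1\}$ and independent $S,S'\sim\mathcal D^n$, $r\sim\mathcal R$, $$\Pr_{S,S'\sim\mathcal D^n,\;r\sim\mathcal R}\big[A'(S,r)\neq A'(S',r)\big]\le\frac{2\rho}{1+\rho}.$$ Here the probability in 3 is understood as $\mathbf E_{S,S'}\big[\Pr_r[A'(S,r)\ne A'(S',r)]\big]$, with outer probabilities and upper expectations where measurability fails. If moreover the densities $f_S(h)$ can be chosen jointly measurable in $(S,h)$ (automatic if $S\mapsto A(S)$ is measurable and the space of samples is countable or the $\sigma$-algebra on $\{0,1\}^{\mathcal X}$ is countably generated), the bound in 3 also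 holds for the outer probability of the event under the product measure $\mathcal D^n\times\mathcal D^n\times\mathcal R$. -/

import Mathlib

open MeasureTheory ProbabilityTheory
open scoped ENNReal NNReal

noncomputable section

/-- The space `{0,1}^X` of binary classifiers. This is a plain definition, so that no σ-algebra on
it is fixed in advance: the theorem is about an arbitrary one. -/
def Classifier (X : Type*) : Type _ := X → Bool

/-- Labelled samples `(X × {0,1})^n`. -/
abbrev Sample (X : Type*) (n : ℕ) : Type _ := Fin n → X × Bool

/-- A (randomized) learning rule: a sample is mapped to a distribution over classifiers. -/
abbrev LearningRule (X : Type*) (n : ℕ) [MeasurableSpace (Classifier X)] : Type _ :=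
  Sample X n → ProbabilityMeasure (Classifier X)

/-- A learning algorithm: a deterministic map of the sample and of the random seed. -/
abbrev LearningAlgorithm (X : Type*) (n : ℕ) (Ω : Type*) : Type _ :=
  Sample X n → Ω → Classifier X

/-- The law `D^n` of a sample of `n` i.i.d. draws from `D`. -/
abbrev iidLaw {X : Type*} [MeasurableSpace X] (n : ℕ) (D : Measure (X × Bool)) :
    Measure (Sample X n) :=
  Measure.pi fun _ => D

/-- Total variation distance `sup_B (P(B) - Q(B))` over measurable `B`. The truncated subtraction
does not change the supremum, since `B = ∅` contributes `0`. -/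
def tvDist {E : Type*} [MeasurableSpace E] (P Q : Measure E) : ℝ≥0∞ :=
  ⨆ (B : Set E) (_ : MeasurableSet B), P B - Q B

/-- The (upper) expectation of a nonnegative function: the least integral of a measurable function
above it. It is the usual expectation if `f` is measurable, see `upperExpectation_eq_lintegral`. -/
def upperExpectation {E : Type*} [MeasurableSpace E] (μ : Measure E) (f : E → ℝ≥0∞) : ℝ≥0∞ :=
  ⨅ (g : E → ℝ≥0∞) (_ : Measurable g) (_ : ∀ x, f x ≤ g x), ∫⁻ x, g x ∂μ

theorem upperExpectation_eq_lintegral {E : Type*} [MeasurableSpace E] (μ : Measure E)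
    {f : E → ℝ≥0∞} (hf : Measurable f) : upperExpectation μ f = ∫⁻ x, f x ∂μ := by
  refine le_antisymm (iInf_le_of_le f (iInf_le_of_le hf (iInf_le_of_le (fun _ => le_rfl) le_rfl)))
    ?_
  exact le_iInf fun g => le_iInf fun _ => le_iInf fun h => lintegral_mono h

/-- `n`-sample `ρ`-TV indistinguishability: `E_{S,S' ∼ D^n} [d_TV(A(S), A(S'))] ≤ ρ` for every
distribution `D` over inputs. -/
def IsTVIndistinguishable {X : Type*} [MeasurableSpace X] [MeasurableSpace (Classifier X)] {n : ℕ}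
    (A : LearningRule X n) (ρ : ℝ≥0) : Prop :=
  ∀ (D : Measure (X × Bool)) [IsProbabilityMeasure D],
    upperExpectation ((iidLaw n D).prod (iidLaw n D))
      (fun p => tvDist (A p.1 : Measure (Classifier X)) (A p.2)) ≤ ρ

/-- `A` is absolutely continuous with respect to `P`: for every distribution `D` over inputs,
`A(S) ≪ P` for almost every sample `S` drawn from `D`. -/
def IsAbsolutelyContinuousRule {X : Type*} [MeasurableSpace X] [MeasurableSpace (Classifier X)]
    {n : ℕ} (A : LearningRule X n) (P : Measure (Classifier X)) : Prop :=
  ∀ (D : Measure (X × Bool)) [IsProbabilityMeasure D],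
    ∀ᵐ S ∂(iidLaw n D), (A S : Measure (Classifier X)) ≪ P

/-- The learning algorithm `A'` with seed distribution `R` is equivalent to the learning rule `A`:
on every sample, `A'(S, ·)` is a random variable whose law is `A(S)`. -/
def IsEquivalentTo {X : Type*} [MeasurableSpace (Classifier X)] {n : ℕ} {Ω : Type*}
    [MeasurableSpace Ω] (A' : LearningAlgorithm X n Ω) (R : Measure Ω) (A : LearningRule X n) :
    Prop :=
  ∀ S, Measurable (A' S) ∧ R.map (A' S) = (A S : Measure (Classifier X))

/-- `n`-sample `ρ`-replicability, with the probability over the independent `S, S', r` written as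
`E_{S,S' ∼ D^n} [Pr_{r ∼ R} [A'(S, r) ≠ A'(S', r)]]`. This makes sense even if the disagreement
event is not measurable in `(S, S', r)`. -/
def IsReplicable {X : Type*} [MeasurableSpace X] {n : ℕ} {Ω : Type*} [MeasurableSpace Ω]
    (A' : LearningAlgorithm X n Ω) (R : Measure Ω) (ρ : ℝ≥0) : Prop :=
  ∀ (D : Measure (X × Bool)) [IsProbabilityMeasure D],
    upperExpectation ((iidLaw n D).prod (iidLaw n D))
      (fun p => R {r | A' p.1 r ≠ A' p.2 r}) ≤ ρ

/-- `n`-sample `ρ`-replicability, with the probability over the independent `S, S', r` taken in the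
product space: the disagreement event has (outer) measure at most `ρ` for `D^n × D^n × R`. -/
def IsJointlyReplicable {X : Type*} [MeasurableSpace X] {n : ℕ} {Ω : Type*} [MeasurableSpace Ω]
    (A' : LearningAlgorithm X n Ω) (R : Measure Ω) (ρ : ℝ≥0) : Prop :=
  ∀ (D : Measure (X × Bool)) [IsProbabilityMeasure D],
    (((iidLaw n D).prod (iidLaw n D)).prod R) {q | A' q.1.1 q.2 ≠ A' q.1.2 q.2} ≤ ρ

/-- The densities `f_S` of the output distributions `A(S)` with respect to `P` can be chosen
measurable in `(S, h)`. Given `A(S) ≪ P` for all `S`, this is automatic (`Kernel.rnDeriv`) if `A` is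
a kernel and the sample space is countable or the σ-algebra on classifiers countably generated. -/
def HasJointlyMeasurableDensity {X : Type*} [MeasurableSpace X] [MeasurableSpace (Classifier X)]
    {n : ℕ} (A : LearningRule X n) (P : Measure (Classifier X)) : Prop :=
  ∃ f : Sample X n × Classifier X → ℝ≥0∞, Measurable f ∧
    ∀ S, (A S : Measure (Classifier X)) = P.withDensity fun h => f (S, h)

/-- The number of points of the sequence `ξ` (counted with multiplicity) that lie in `B`. -/
def pointCount {Ω E : Type*} (ξ : ℕ → Ω → E) (B : Set E) (ω : Ω) : ℕ∞ :=
  {i : ℕ | ξ i ω ∈ B}.encard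

/-- The random points `ξ 0, ξ 1, …` form a Poisson point process with intensity measure `Λ`: the
number of points in a measurable set `B` of finite intensity is Poisson with mean `Λ B`, and the
numbers of points in disjoint measurable sets are independent. -/
structure IsPoissonPointProcess {Ω E : Type*} [MeasurableSpace Ω] [MeasurableSpace E]
    (ξ : ℕ → Ω → E) (Λ : Measure E) (R : Measure Ω) : Prop where
  measurable : ∀ i, Measurable (ξ i)
  count_law : ∀ B : Set E, MeasurableSet B → Λ B ≠ ∞ → ∀ k : ℕ,
    R {ω | pointCount ξ B ω = k} = poissonMeasure (Λ B).toNNReal {k}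
  count_indep : ∀ (m : ℕ) (B : Fin m → Set E), (∀ l, MeasurableSet (B l)) →
    (∀ l l', l ≠ l' → Disjoint (B l) (B l')) → iIndepFun (fun l => pointCount ξ (B l)) R

/-- Seeds: infinite sequences of points `(h_i, y_i, t_i)`, where `h_i` is a classifier, `y_i` a
height and `t_i` a time. -/
abbrev Seed (X : Type*) : Type _ := ℕ → Classifier X × ℝ × ℝ

/-- Lebesgue measure on `ℝ_+`. -/
abbrev lebNonneg : Measure ℝ := volume.restrict (Set.Ici 0)

/-- `h` is the classifier of the first accepted point of the seed `r`: a point `(h_i, y_i, t_i)` is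
accepted if `y_i < f(h_i)`, and among the accepted points there is one with the strictly smallest
time `t_j`, and `h = h_j`. -/
def IsFirstAccepted {X : Type*} (f : Classifier X → ℝ≥0∞) (r : Seed X) (h : Classifier X) : Prop :=
  ∃ j, ENNReal.ofReal (r j).2.1 < f (r j).1 ∧
    (∀ i, i ≠ j → ENNReal.ofReal (r i).2.1 < f (r i).1 → (r j).2.2 < (r i).2.2) ∧ h = (r j).1

end

/-! Let the seed be a Poisson cloud of points (h, y, t) with intensity P × Leb × Leb, where t is
read as time. For a density f of A(S), accept the points under the graph of f, a region of P ×
Leb-mass 1. The position of the earliest point in a region U of finite positive mass is uniform in U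
(`measure_isFirstPoint`), so the mark of the first accepted point has law f dP = A(S)
(`map_rejectionSample`).

All samples share one cloud. For densities f and g at total variation distance d, the regions under
max(f, g) and min(f, g) have masses 1 + d and 1 - d. If the earliest point of the larger region lies
in the smaller one, it is the first accepted point for both f and g. This fails with probability 1 -
(1 - d)/(1 + d) = 2d/(1 + d). That function is concave in d, so averaging over S, S' gives 2ρ/(1 +
ρ). Instead of Jensen, `measure_not_exists_isFirstPoint_le` uses the tangent at ρ, an affine bound
that passes through upper expectations.

Uniformity of the earliest point comes from cutting time into slots of length δ: counts in disjoint
boxes are independent Poisson, the slots add up to a geometric series, and δ → 0 removes the slots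
holding several points. The cloud is built because its intensity is a countable sum of probability
measures: each contributes an independent cluster of Poisson(1) many i.i.d. points. Finally,
absolute continuity holds for every S, not just almost every S, since some D charges S. -/

noncomputable section

open Filter Topology

/-! ### Counts of points in independent Poisson clusters -/

section PoissonConstruction

variable {E : Type*}

open Classical in
/-- The points of a cluster that lie in `B`, given by their indices. -/
def clusterIndices (B : Set E) (w : ℕ × (ℕ → E)) : Finset ℕ :=
  (Finset.range w.1).filter fun i => w.2 i ∈ B

lemma mem_clusterIndices {B : Set E} {w : ℕ × (ℕ → E)} {i : ℕ} :
    i ∈ clusterIndices B w ↔ i < w.1 ∧ w.2 i ∈ B := by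
  simp [clusterIndices]

/-- The number of points in `B` of the first `K` clusters. -/
def partialCount (B : Set E) (K : ℕ) (ω : ℕ → ℕ × (ℕ → E)) : ℕ :=
  ∑ k ∈ Finset.range K, (clusterIndices B (ω k)).card

lemma partialCount_mono (B : Set E) (ω : ℕ → ℕ × (ℕ → E)) :
    Monotone fun K => partialCount B K ω := fun _ _ h =>
  Finset.sum_le_sum_of_subset (Finset.range_mono h)

variable [MeasurableSpace E]

/-- A Poisson number (of mean one) of points together with an i.i.d. sequence of positions. -/
def clusterLaw (μ : Measure E) [IsProbabilityMeasure μ] : Measure (ℕ × (ℕ → E)) :=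
  (poissonMeasure 1).prod (Measure.infinitePi fun _ : ℕ => μ)

instance (μ : Measure E) [IsProbabilityMeasure μ] : IsProbabilityMeasure (clusterLaw μ) := by
  unfold clusterLaw; infer_instance

/-- Independent clusters. -/
def clustersLaw (μ : ℕ → Measure E) [∀ k, IsProbabilityMeasure (μ k)] :
    Measure (ℕ → ℕ × (ℕ → E)) :=
  Measure.infinitePi fun k => clusterLaw (μ k)

instance (μ : ℕ → Measure E) [∀ k, IsProbabilityMeasure (μ k)] :
    IsProbabilityMeasure (clustersLaw μ) := by
  unfold clustersLaw; infer_instance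

lemma measurable_sum_range {φ : E → ℝ} (hφ : Measurable φ) :
    Measurable fun w : ℕ × (ℕ → E) => ∑ i ∈ Finset.range w.1, φ (w.2 i) := by
  apply measurable_from_prod_countable_right
  intro n
  exact Finset.measurable_sum (Finset.range n) (f := fun i (x : ℕ → E) => φ (x i))
    fun i _ => hφ.comp (measurable_pi_apply i)

lemma measurable_card_clusterIndices {B : Set E} (hB : MeasurableSet B) :
    Measurable fun w : ℕ × (ℕ → E) => (clusterIndices B w).card := by
  classical
  apply measurable_from_prod_countable_right
  intro n
  simp only [clusterIndices, Finset.card_filter]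
  refine Finset.measurable_sum _ fun i _ => ?_
  exact Measurable.ite ((measurable_pi_apply i) hB) measurable_const measurable_const

lemma measurable_partialCount {B : Set E} (hB : MeasurableSet B) (K : ℕ) :
    Measurable (partialCount B K) :=
  Finset.measurable_sum _ fun k _ =>
    (measurable_card_clusterIndices hB).comp (measurable_pi_apply k)

/-- The characteristic function of a compound Poisson sum. -/
lemma charFun_clusterLaw (μ : Measure E) [IsProbabilityMeasure μ] {φ : E → ℝ}
    (hφ : Measurable φ) :
    ∫ w, Complex.exp ((∑ i ∈ Finset.range w.1, φ (w.2 i) : ℝ) * Complex.I) ∂(clusterLaw μ) =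
      Complex.exp (∫ x, (Complex.exp (φ x * Complex.I) - 1) ∂μ) := by
  have hint : Integrable (fun x => Complex.exp (φ x * Complex.I)) μ := by
    refine Integrable.of_bound (C := 1) (by fun_prop) (ae_of_all _ fun x => ?_)
    simp [Complex.norm_exp_ofReal_mul_I]
  have hiid : ∀ n : ℕ, ∫ x : ℕ → E, Complex.exp
      ((∑ i ∈ Finset.range n, φ (x i) : ℝ) * Complex.I) ∂(Measure.infinitePi fun _ : ℕ => μ) =
      (∫ x, Complex.exp (φ x * Complex.I) ∂μ) ^ n := by
    intro n
    have hm : ∀ i, Measurable fun x : ℕ → E => φ (x i) := fun i => hφ.comp (measurable_pi_apply i)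
    have h := iIndepFun_infinitePi (P := fun _ : ℕ => μ) (X := fun _ => φ) (fun _ => hφ)
    have h' := congrFun (iIndepFun.charFun_map_fun_finsetSum_eq_prod (s := Finset.range n)
      (fun i _ => (hm i).aemeasurable) (h.restrict _)) 1
    rw [charFun_apply_real, integral_map
      (Finset.measurable_sum _ fun i _ => hm i).aemeasurable (by fun_prop)] at h'
    simp only [Complex.ofReal_one, one_mul] at h'
    rw [h', Finset.prod_apply, Finset.prod_congr rfl (g := fun _ =>
      ∫ x, Complex.exp (φ x * Complex.I) ∂μ)]
    · simp
    · intro i _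
      rw [charFun_apply_real, integral_map (hm i).aemeasurable (by fun_prop)]
      have := (measurePreserving_eval_infinitePi (fun _ : ℕ => μ) i).map_eq
      conv_rhs => rw [← this]
      rw [integral_map (measurable_pi_apply i).aemeasurable (by fun_prop)]
      simp
  -- Given a cluster size N = n the integral is z ^ n, where z is the characteristic function of one
  -- summand; the Poisson(1) average of z ^ N is exp(z - 1).
  rw [clusterLaw, integral_prod]
  · simp only [hiid]
    rw [integral_poissonMeasure, integral_sub hint (integrable_const _)]
    simp only [integral_const, probReal_univ, one_smul]
    set z := ∫ x, Complex.exp (φ x * Complex.I) ∂μ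
    have : ∀ n : ℕ, ((Real.exp (-(1 : ℝ≥0)) * (1 : ℝ≥0) ^ n / n.factorial : ℝ)) • z ^ n =
        Complex.exp (-1) * (z ^ n / n.factorial) := by
      intro n
      rw [Complex.real_smul]
      push_cast
      simp
      ring
    simp only [this]
    rw [tsum_mul_left, (NormedSpace.expSeries_div_hasSum_exp z).tsum_eq, ← Complex.exp_eq_exp_ℂ,
      ← Complex.exp_add]
    ring_nf
  · refine Integrable.of_bound (C := 1) ?_ (ae_of_all _ fun x => ?_)
    · exact (Complex.measurable_exp.comp ((Complex.measurable_ofReal.comp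
        (measurable_sum_range hφ)).mul_const _)).aestronglyMeasurable
    · simp only [Complex.norm_exp_ofReal_mul_I]; exact le_rfl

lemma charFun_clustersLaw (μ : ℕ → Measure E) [∀ k, IsProbabilityMeasure (μ k)] {φ : E → ℝ}
    (hφ : Measurable φ) (K : ℕ) :
    ∫ ω, Complex.exp ((∑ k ∈ Finset.range K, ∑ i ∈ Finset.range (ω k).1, φ ((ω k).2 i) : ℝ) *
      Complex.I) ∂(clustersLaw μ) =
      Complex.exp (∑ k ∈ Finset.range K, ∫ x, (Complex.exp (φ x * Complex.I) - 1) ∂(μ k)) := by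
  have hm := measurable_sum_range hφ
  have h := iIndepFun_infinitePi (P := fun k : ℕ => clusterLaw (μ k))
    (X := fun _ w => ∑ i ∈ Finset.range w.1, φ (w.2 i)) (fun _ => hm)
  have hm' : ∀ k : ℕ, Measurable fun ω : ℕ → ℕ × (ℕ → E) =>
      ∑ i ∈ Finset.range (ω k).1, φ ((ω k).2 i) := fun k => hm.comp (measurable_pi_apply k)
  have h' := congrFun (iIndepFun.charFun_map_fun_finsetSum_eq_prod (s := Finset.range K)
      (fun i _ => (hm' i).aemeasurable) (h.restrict _)) 1
  rw [charFun_apply_real, integral_map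
    (Finset.measurable_sum _ fun i _ => hm' i).aemeasurable (by fun_prop)] at h'
  simp only [Complex.ofReal_one, one_mul] at h'
  rw [clustersLaw, h', Finset.prod_apply, Complex.exp_sum]
  refine Finset.prod_congr rfl fun k _ => ?_
  rw [charFun_apply_real, integral_map (hm' k).aemeasurable (by fun_prop),
    ← charFun_clusterLaw _ hφ]
  have := (measurePreserving_eval_infinitePi (fun k : ℕ => clusterLaw (μ k)) k).map_eq
  conv_rhs => rw [← this]
  rw [integral_map (measurable_pi_apply k).aemeasurable (Complex.measurable_exp.comp
    ((Complex.measurable_ofReal.comp hm).mul_const _)).aestronglyMeasurable]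
  simp

/-- The numbers of points of the first `K` clusters in disjoint sets are independent Poisson
variables. -/
lemma map_partialCount {ι : Type*} [Fintype ι] (μ : ℕ → Measure E)
    [∀ k, IsProbabilityMeasure (μ k)] (K : ℕ) {B : ι → Set E} (hB : ∀ l, MeasurableSet (B l))
    (hd : ∀ l l', l ≠ l' → Disjoint (B l) (B l')) :
    (clustersLaw μ).map (fun ω l => (partialCount (B l) K ω : ℝ)) =
      Measure.pi fun l => (poissonMeasure (∑ k ∈ Finset.range K, μ k (B l)).toNNReal).map
        (Nat.cast : ℕ → ℝ) := by
  classical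
  have hmeas : Measurable fun ω l => (partialCount (B l) K ω : ℝ) := by
    refine measurable_pi_lambda _ fun l => ?_
    exact measurable_from_top.comp (measurable_partialCount (hB l) K)
  rw [← charFun_eq_pi_iff]
  intro t
  -- Summing φ over the points gives the pairing of the count vector with t, so the compound Poisson
  -- formula applies to the joint characteristic function.
  set φ : E → ℝ := fun x => ∑ l, (B l).indicator (fun _ => t l) x with hφ_def
  have hφ : Measurable φ :=
    Finset.measurable_sum _ fun l _ => measurable_const.indicator (hB l)
  -- At most one indicator is nonzero at x by disjointness, so the exponent splits into one term per
  -- set; this is the independence.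
  have hexp : ∀ x, Complex.exp (φ x * Complex.I) - 1 =
      ∑ l, (B l).indicator (fun _ => Complex.exp (t l * Complex.I) - 1) x := by
    intro x
    by_cases hx : ∃ l, x ∈ B l
    · obtain ⟨l, hl⟩ := hx
      have hne : ∀ l', l' ≠ l → x ∉ B l' := fun l' h h' =>
        Set.disjoint_left.1 (hd l' l h) h' hl
      have h1 : φ x = t l := by
        rw [hφ_def]
        simp only
        rw [Finset.sum_eq_single l (fun l' _ h => Set.indicator_of_notMem (hne l' h) _) (by simp),
          Set.indicator_of_mem hl]
      rw [h1, Finset.sum_eq_single l (fun l' _ h => Set.indicator_of_notMem (hne l' h) _) (by simp),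
          Set.indicator_of_mem hl]
    · push Not at hx
      simp [hφ_def, Set.indicator_of_notMem (hx _)]
  have hsum : ∀ ω : ℕ → ℕ × (ℕ → E), ∑ l, (partialCount (B l) K ω : ℝ) * t l =
      ∑ k ∈ Finset.range K, ∑ i ∈ Finset.range (ω k).1, φ ((ω k).2 i) := by
    intro ω
    simp only [partialCount, hφ_def, Nat.cast_sum, Finset.sum_mul]
    rw [Finset.sum_comm]
    refine Finset.sum_congr rfl fun k _ => ?_
    rw [Finset.sum_comm]
    refine Finset.sum_congr rfl fun l _ => ?_
    rw [← Finset.sum_filter_add_sum_filter_not _ fun i => (ω k).2 i ∈ B l,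
      Finset.sum_congr rfl fun i hi => Set.indicator_of_mem (Finset.mem_filter.1 hi).2 _,
      Finset.sum_eq_zero (s := Finset.filter (fun i => (ω k).2 i ∉ B l) _)
        fun i hi => Set.indicator_of_notMem (Finset.mem_filter.1 hi).2 _]
    simp only [Finset.sum_const, nsmul_eq_mul, add_zero, clusterIndices]
  rw [charFun_apply, integral_map (by fun_prop) (by fun_prop), integral_map hmeas.aemeasurable
    (by fun_prop)]
  have hinner : ∀ ω : ℕ → ℕ × (ℕ → E), inner ℝ (WithLp.toLp 2 fun l =>
      (partialCount (B l) K ω : ℝ)) t = ∑ k ∈ Finset.range K,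
        ∑ i ∈ Finset.range (ω k).1, φ ((ω k).2 i) := by
    intro ω
    rw [← hsum, PiLp.inner_apply]
    simp [mul_comm]
  simp only [hinner]
  rw [charFun_clustersLaw μ hφ]
  simp only [charFun_map_cast_poissonMeasure, ← Complex.exp_sum]
  congr 1
  have hk : ∀ k, ∫ x, (Complex.exp (φ x * Complex.I) - 1) ∂(μ k) =
      ∑ l, ((μ k).real (B l) : ℂ) * (Complex.exp (t l * Complex.I) - 1) := by
    intro k
    simp only [hexp]
    rw [integral_finsetSum _ fun l _ => (integrable_const _).indicator (hB l)]
    refine Finset.sum_congr rfl fun l _ => ?_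
    rw [integral_indicator (hB l), setIntegral_const, Complex.real_smul]
  simp only [hk]
  rw [Finset.sum_comm]
  refine Finset.sum_congr rfl fun l _ => ?_
  rw [← Finset.sum_mul]
  congr 1
  have : (((∑ k ∈ Finset.range K, μ k (B l)).toNNReal : ℝ)) =
      ∑ k ∈ Finset.range K, (μ k).real (B l) := by
    rw [ENNReal.coe_toNNReal_eq_toReal, ENNReal.toReal_sum (fun k _ => measure_ne_top _ _)]
    rfl
  rw [this]
  push_cast
  rfl

lemma measure_partialCount_le {ι : Type*} [Fintype ι] (μ : ℕ → Measure E)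
    [∀ k, IsProbabilityMeasure (μ k)] (K : ℕ) {B : ι → Set E} (hB : ∀ l, MeasurableSet (B l))
    (hd : ∀ l l', l ≠ l' → Disjoint (B l) (B l')) (m : ι → ℕ) :
    clustersLaw μ {ω | ∀ l, partialCount (B l) K ω ≤ m l} =
      ∏ l, poissonMeasure (∑ k ∈ Finset.range K, μ k (B l)).toNNReal (Set.Iic (m l)) := by
  have hmeas : Measurable fun ω l => (partialCount (B l) K ω : ℝ) := by
    refine measurable_pi_lambda _ fun l => ?_
    exact measurable_from_top.comp (measurable_partialCount (hB l) K)
  have h := congrArg (fun ν => ν (Set.univ.pi fun l => Set.Iic (m l : ℝ)))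
    (map_partialCount μ K hB hd)
  simp only [Measure.pi_pi] at h
  rw [Measure.map_apply hmeas (MeasurableSet.univ_pi fun _ => measurableSet_Iic)] at h
  convert h using 1
  · congr 1
    ext ω
    simp [Pi.le_def]
  · refine Finset.prod_congr rfl fun l _ => ?_
    rw [Measure.map_apply .of_discrete measurableSet_Iic]
    congr 1
    ext k
    simp

/-- Partial counts grow with K, so the events decrease and continuity from above applies. This is
why lower tails are used throughout. -/
lemma tendsto_measure_partialCount_le {ι : Type*} [Fintype ι] (μ : ℕ → Measure E)
    [∀ k, IsProbabilityMeasure (μ k)] {B : ι → Set E} (hB : ∀ l, MeasurableSet (B l))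
    (m : ι → ℕ) :
    Tendsto (fun K => clustersLaw μ {ω | ∀ l, partialCount (B l) K ω ≤ m l}) atTop
      (𝓝 (clustersLaw μ {ω | ∀ l K, partialCount (B l) K ω ≤ m l})) := by
  have : {ω | ∀ l K, partialCount (B l) K ω ≤ m l} =
      ⋂ K, {ω | ∀ l, partialCount (B l) K ω ≤ m l} := by
    ext ω
    simp only [Set.mem_ofPred_eq, Set.mem_iInter]
    exact forall_comm
  rw [this]
  refine tendsto_measure_iInter_atTop (fun K => ?_) (fun K K' h ω hω l => ?_)
    ⟨0, measure_ne_top _ _⟩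
  · have : {ω : ℕ → ℕ × (ℕ → E) | ∀ l, partialCount (B l) K ω ≤ m l} =
        ⋂ l, partialCount (B l) K ⁻¹' Set.Iic (m l) := by ext; simp
    rw [this]
    exact (MeasurableSet.iInter fun l =>
      measurable_partialCount (hB l) K .of_discrete).nullMeasurableSet
  · exact (partialCount_mono _ ω h).trans (hω l)

lemma tendsto_poissonMeasure_Iic (m : ℕ) {r : ℕ → ℝ≥0} {r₀ : ℝ≥0} (h : Tendsto r atTop (𝓝 r₀)) :
    Tendsto (fun K => poissonMeasure (r K) (Set.Iic m)) atTop
      (𝓝 (poissonMeasure r₀ (Set.Iic m))) := by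
  have key : ∀ s : ℝ≥0, poissonMeasure s (Set.Iic m) =
      ∑ n ∈ Finset.Iic m, ENNReal.ofReal (Real.exp (-s) * s ^ n / n.factorial) := by
    intro s
    rw [← Finset.coe_Iic, ← sum_measure_singleton]
    simp only [poissonMeasure_singleton]
  simp only [key]
  refine tendsto_finsetSum _ fun n _ => ENNReal.tendsto_ofReal ?_
  have h' : Tendsto (fun K => (r K : ℝ)) atTop (𝓝 r₀) := NNReal.tendsto_coe.2 h
  exact (((Real.continuous_exp.tendsto _).comp h'.neg).mul (h'.pow n)).div_const _

/-- The product formula for K clusters survives the limit. The intensities of the sets may be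
infinite here, as independence of counts requires. -/
lemma measure_forall_partialCount_le_prod {ι : Type*} [Fintype ι] (μ : ℕ → Measure E)
    [∀ k, IsProbabilityMeasure (μ k)] {B : ι → Set E} (hB : ∀ l, MeasurableSet (B l))
    (hd : ∀ l l', l ≠ l' → Disjoint (B l) (B l')) (m : ι → ℕ) :
    clustersLaw μ {ω | ∀ l K, partialCount (B l) K ω ≤ m l} =
      ∏ l, clustersLaw μ {ω | ∀ K, partialCount (B l) K ω ≤ m l} := by
  have h1 := tendsto_measure_partialCount_le μ hB m
  refine tendsto_nhds_unique h1 ?_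
  have h2 : ∀ l, Tendsto (fun K => poissonMeasure (∑ k ∈ Finset.range K, μ k (B l)).toNNReal
      (Set.Iic (m l))) atTop (𝓝 (clustersLaw μ {ω | ∀ K, partialCount (B l) K ω ≤ m l})) := by
    intro l
    have := tendsto_measure_partialCount_le (ι := Unit) μ (fun _ => hB l) (fun _ => m l)
    simp only [measure_partialCount_le (ι := Unit) μ _ (fun _ => hB l)
      (fun _ _ h => absurd rfl h)] at this
    simpa using this
  simp only [measure_partialCount_le μ _ hB hd]
  exact ENNReal.tendsto_finsetProd_of_ne_top _ (fun l _ => h2 l) fun l _ => measure_ne_top _ _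

lemma measure_forall_partialCount_le (μ : ℕ → Measure E)
    [∀ k, IsProbabilityMeasure (μ k)] {B : Set E} (hB : MeasurableSet B)
    (hfin : Measure.sum μ B ≠ ∞) (m : ℕ) :
    clustersLaw μ {ω | ∀ K, partialCount B K ω ≤ m} =
      poissonMeasure (Measure.sum μ B).toNNReal (Set.Iic m) := by
  have h1 := tendsto_measure_partialCount_le (ι := Unit) μ (fun _ => hB) (fun _ => m)
  simp only [measure_partialCount_le (ι := Unit) μ _ (fun _ => hB)
      (fun _ _ h => absurd rfl h)] at h1
  simp only [Finset.univ_unique, Finset.prod_singleton, forall_const] at h1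
  refine tendsto_nhds_unique h1 (tendsto_poissonMeasure_Iic m ?_)
  refine (ENNReal.tendsto_toNNReal hfin).comp ?_
  rw [Measure.sum_apply _ hB]
  exact ENNReal.tendsto_nat_tsum _

end PoissonConstruction

/-! ### Enumerating the clusters as a single Poisson sequence -/

section PoissonEnumeration

variable {E : Type*}

lemma encard_le_natCast_iff {α : Type*} (s : Set α) (n : ℕ) :
    s.encard ≤ n ↔ ∀ t : Finset α, (∀ i ∈ t, i ∈ s) → t.card ≤ n := by
  constructor
  · intro h t ht
    have : (t : Set α).encard ≤ s.encard := Set.encard_le_encard ht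
    rw [Set.encard_coe_eq_coe_finsetCard] at this
    exact_mod_cast this.trans h
  · intro h
    by_contra! hlt
    have hle : ((n + 1 : ℕ) : ℕ∞) ≤ s.encard := by
      rw [Nat.cast_add, Nat.cast_one]
      exact Order.add_one_le_of_lt hlt
    obtain ⟨t, hts, ht⟩ := Set.exists_subset_encard_eq hle
    have htf : t.Finite := Set.finite_of_encard_eq_coe ht
    have := h htf.toFinset fun i hi => hts (by simpa using hi)
    rw [← htf.coe_toFinset, Set.encard_coe_eq_coe_finsetCard] at ht
    have ht' : htf.toFinset.card = n + 1 := by exact_mod_cast ht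
    omega

/-- The pair of a cluster and a position coded by `j` is an actual point. -/
def IsPointIndex (ω : ℕ → ℕ × (ℕ → E)) (j : ℕ) : Prop :=
  j.unpair.2 < (ω j.unpair.1).1

/-- All points of all clusters, as one sequence. -/
def clusterPoints (ω : ℕ → ℕ × (ℕ → E)) (m : ℕ) : E :=
  (ω (Nat.nth (IsPointIndex ω) m).unpair.1).2 (Nat.nth (IsPointIndex ω) m).unpair.2

/-- A possibly infinite count is bounded by n exactly when all its finite subsets are, and any
finite set of codes involves only finitely many clusters. -/
lemma encard_le_iff_partialCount_le (B : Set E) (ω : ℕ → ℕ × (ℕ → E)) (n : ℕ) :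
    {j | IsPointIndex ω j ∧ (ω j.unpair.1).2 j.unpair.2 ∈ B}.encard ≤ n ↔
      ∀ K, partialCount B K ω ≤ n := by
  set T := {j | IsPointIndex ω j ∧ (ω j.unpair.1).2 j.unpair.2 ∈ B} with hT
  let F : ℕ → Finset ℕ := fun K =>
    ((Finset.range K).sigma fun k => clusterIndices B (ω k)).image fun p => Nat.pair p.1 p.2
  have hF : ∀ K, (F K).card = partialCount B K ω := by
    intro K
    rw [Finset.card_image_of_injective, Finset.card_sigma]
    · rfl
    · rintro ⟨a, b⟩ ⟨c, d⟩ h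
      simp only [Nat.pair_eq_pair] at h
      obtain ⟨rfl, rfl⟩ := h
      rfl
  have hmem : ∀ K j, j ∈ F K ↔ j.unpair.1 < K ∧ j ∈ T := by
    intro K j
    simp only [F, Finset.mem_image, Finset.mem_sigma, Finset.mem_range, mem_clusterIndices, hT,
      IsPointIndex, Set.mem_ofPred_eq]
    constructor
    · rintro ⟨⟨a, b⟩, h, rfl⟩
      simpa using h
    · intro h
      exact ⟨⟨j.unpair.1, j.unpair.2⟩, h, Nat.pair_unpair j⟩
  rw [encard_le_natCast_iff]
  constructor
  · intro h K
    rw [← hF]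
    exact h (F K) fun j hj => ((hmem K j).1 hj).2
  · intro h t ht
    obtain ⟨K, hK⟩ := (t.finite_toSet.image fun j => j.unpair.1).bddAbove
    refine le_trans (Finset.card_le_card fun j hj => ?_) ((hF (K + 1)).trans_le (h _))
    exact (hmem _ j).2 ⟨Nat.lt_succ_of_le (hK ⟨j, hj, rfl⟩), ht j hj⟩

lemma pointCount_clusterPoints {ω : ℕ → ℕ × (ℕ → E)} (hω : {j | IsPointIndex ω j}.Infinite)
    (B : Set E) :
    {m | clusterPoints ω m ∈ B}.encard =
      {j | IsPointIndex ω j ∧ (ω j.unpair.1).2 j.unpair.2 ∈ B}.encard := by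
  rw [← (Nat.nth_injective hω).encard_image]
  congr 1
  ext j
  constructor
  · rintro ⟨m, hm, rfl⟩
    exact ⟨Nat.nth_mem_of_infinite hω m, hm⟩
  · rintro ⟨hj, hB⟩
    have : j ∈ Set.range (Nat.nth (IsPointIndex ω)) := by
      rw [Nat.range_nth_of_infinite hω]; exact hj
    obtain ⟨m, rfl⟩ := this
    exact ⟨m, hB, rfl⟩

variable [MeasurableSpace E]

lemma measurableSet_isPointIndex (j : ℕ) :
    MeasurableSet {ω : ℕ → ℕ × (ℕ → E) | IsPointIndex ω j} := by
  have : Measurable fun ω : ℕ → ℕ × (ℕ → E) => (ω j.unpair.1).1 :=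
    measurable_fst.comp (measurable_pi_apply _)
  exact this (t := Set.Ioi j.unpair.2) .of_discrete

lemma measurable_nth_isPointIndex (m : ℕ) :
    Measurable fun ω : ℕ → ℕ × (ℕ → E) => Nat.nth (IsPointIndex ω) m := by
  classical
  have hcount : ∀ j, Measurable fun ω : ℕ → ℕ × (ℕ → E) => Nat.count (IsPointIndex ω) j := by
    intro j
    simp only [Nat.count_eq_card_filter_range, Finset.card_filter]
    exact Finset.measurable_sum _ fun i _ =>
      Measurable.ite (measurableSet_isPointIndex i) measurable_const measurable_const
  -- The value 0 is set apart because `Nat.nth` also returns it by default when there are too few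
  -- indices; its preimage is the complement of all the others.
  have hpos : ∀ j, j ≠ 0 → MeasurableSet
      {ω : ℕ → ℕ × (ℕ → E) | Nat.nth (IsPointIndex ω) m = j} := by
    intro j hj
    have : {ω : ℕ → ℕ × (ℕ → E) | Nat.nth (IsPointIndex ω) m = j} =
        {ω | IsPointIndex ω j} ∩ {ω | Nat.count (IsPointIndex ω) j = m} := by
      ext ω
      constructor
      · rintro rfl
        have hm : ∀ hf : (Set.ofPred (IsPointIndex ω)).Finite, m < hf.toFinset.card := by
          intro hf
          by_contra! hle
          exact hj (Nat.nth_of_card_le hf hle)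
        exact ⟨Nat.nth_mem m hm, Nat.count_nth hm⟩
      · rintro ⟨h1, rfl⟩
        exact Nat.nth_count h1
    rw [this]
    exact (measurableSet_isPointIndex j).inter (hcount j (t := {m}) .of_discrete)
  refine measurable_to_countable' fun j => ?_
  rcases eq_or_ne j 0 with rfl | hj
  · have : (fun ω : ℕ → ℕ × (ℕ → E) => Nat.nth (IsPointIndex ω) m) ⁻¹' {0} =
        (⋃ (j : ℕ) (_ : j ≠ 0), {ω | Nat.nth (IsPointIndex ω) m = j})ᶜ := by
      ext ω
      simp only [Set.mem_preimage, Set.mem_singleton_iff, Set.mem_compl_iff, Set.mem_iUnion,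
        Set.mem_ofPred_eq, exists_prop, exists_eq_right', not_not]
    rw [this]
    exact (MeasurableSet.iUnion fun j => MeasurableSet.iUnion fun hj => hpos j hj).compl
  · exact hpos j hj

lemma measurable_clusterPoints : Measurable (clusterPoints (E := E)) := by
  refine measurable_pi_lambda _ fun m => ?_
  have h : Measurable fun p : ℕ × (ℕ → ℕ × (ℕ → E)) => (p.2 p.1.unpair.1).2 p.1.unpair.2 := by
    apply measurable_from_prod_countable_right
    intro j
    exact (measurable_pi_apply j.unpair.2).comp (measurable_snd.comp
      (measurable_pi_apply j.unpair.1))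
  exact h.comp ((measurable_nth_isPointIndex m).prodMk measurable_id)

/-- Second Borel–Cantelli: the clusters are independent and each is nonempty with the same positive
probability. Infinitely many points are needed for `Nat.nth` to enumerate them without default
values. -/
lemma ae_infinite_isPointIndex (μ : ℕ → Measure E) [∀ k, IsProbabilityMeasure (μ k)] :
    ∀ᵐ ω ∂(clustersLaw μ), {j | IsPointIndex ω j}.Infinite := by
  have hm : ∀ k, MeasurableSet {ω : ℕ → ℕ × (ℕ → E) | (ω k).1 ≠ 0} := fun k =>
    (measurable_fst.comp (measurable_pi_apply k)) (t := {0}ᶜ) .of_discrete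
  have hind : iIndepSet (fun k => {ω : ℕ → ℕ × (ℕ → E) | (ω k).1 ≠ 0}) (clustersLaw μ) := by
    have h := iIndepFun_infinitePi (P := fun k : ℕ => clusterLaw (μ k))
      (X := fun _ w => w.1) (fun _ => measurable_fst)
    rw [iIndepSet_iff_meas_biInter hm]
    intro s
    exact h.measure_inter_preimage_eq_mul s (sets := fun _ => {0}ᶜ) fun _ _ => .of_discrete
  have hval : ∀ k, clustersLaw μ {ω | (ω k).1 ≠ 0} = poissonMeasure 1 {0}ᶜ := by
    intro k
    have h1 := (measurePreserving_eval_infinitePi (fun k : ℕ => clusterLaw (μ k)) k)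
    have h2 : MeasurePreserving (Prod.fst) (clusterLaw (μ k)) (poissonMeasure 1) :=
      measurePreserving_fst
    exact (h2.comp h1).measure_preimage (s := {0}ᶜ) (MeasurableSet.of_discrete).nullMeasurableSet
  have hne : poissonMeasure 1 ({0}ᶜ : Set ℕ) ≠ 0 := by
    have h1 : poissonMeasure 1 {1} ≠ 0 := by
      rw [poissonMeasure_singleton]
      simp [Real.exp_pos]
    exact fun h => h1 (measure_mono_null (by simp) h)
  have hlim := measure_limsup_eq_one hm hind
    (by simp only [hval]; exact ENNReal.tsum_const_eq_top_of_ne_zero hne)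
  have hae : ∀ᵐ ω ∂(clustersLaw μ),
      ω ∈ limsup (fun k => {ω : ℕ → ℕ × (ℕ → E) | (ω k).1 ≠ 0}) atTop := by
    rw [← prob_compl_eq_zero_iff (MeasurableSet.measurableSet_limsup hm)] at hlim
    exact hlim
  filter_upwards [hae] with ω hω
  rw [limsup_eq_iInf_iSup_of_nat] at hω
  simp only [Set.iInf_eq_iInter, Set.iSup_eq_iUnion, Set.mem_iInter, Set.mem_iUnion] at hω
  rw [Set.infinite_iff_exists_gt]
  intro a
  obtain ⟨k, hk, hne⟩ := hω (a + 1)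
  refine ⟨Nat.pair k 0, ?_, ?_⟩
  · simpa [IsPointIndex, Nat.pos_iff_ne_zero] using hne
  · exact lt_of_lt_of_le (Nat.lt_of_succ_le hk) (Nat.left_le_pair k 0)

lemma measurableSet_pointCount_le {Ω : Type*} [MeasurableSpace Ω] {ξ : ℕ → Ω → E}
    (hξ : ∀ i, Measurable (ξ i)) {B : Set E} (hB : MeasurableSet B) (n : ℕ) :
    MeasurableSet {ω | pointCount ξ B ω ≤ n} := by
  have : {ω | pointCount ξ B ω ≤ n} =
      ⋂ (s : Finset ℕ), {ω | (∀ i ∈ s, ξ i ω ∈ B) → s.card ≤ n} := by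
    ext ω
    simp only [pointCount, encard_le_natCast_iff, Set.mem_ofPred_eq, Set.mem_iInter]
  rw [this]
  refine MeasurableSet.iInter fun s => ?_
  by_cases hs : s.card ≤ n
  · simp [hs]
  · have : {ω | (∀ i ∈ s, ξ i ω ∈ B) → s.card ≤ n} = (⋂ i ∈ s, ξ i ⁻¹' B)ᶜ := by
      ext ω
      simp [hs]
    rw [this]
    exact (Finset.measurableSet_biInter s fun i _ => hξ i hB).compl

/-- Initial segments form a π-system, so lower tails determine measurability and independence of
counts. -/
lemma ENat.generateFrom_Iic_natCast :
    (⊤ : MeasurableSpace ℕ∞) = MeasurableSpace.generateFrom {s | ∃ n : ℕ, s = Set.Iic (n : ℕ∞)} := by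
  refine le_antisymm ?_ le_top
  set m := MeasurableSpace.generateFrom {s : Set ℕ∞ | ∃ n : ℕ, s = Set.Iic (n : ℕ∞)}
  have hI : ∀ n : ℕ, MeasurableSet[m] (Set.Iic (n : ℕ∞)) := fun n =>
    MeasurableSpace.measurableSet_generateFrom ⟨n, rfl⟩
  have hfin : ∀ n : ℕ, MeasurableSet[m] {(n : ℕ∞)} := by
    intro n
    cases n with
    | zero =>
      have := hI 0
      convert this using 1
      ext x; simp
    | succ n =>
      have := (hI (n + 1)).diff (hI n)
      convert this using 1
      ext x
      cases x with
      | top => simp [-Nat.cast_add, (ENat.natCast_ne_top (n + 1)).symm]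
      | coe x =>
        simp only [Set.mem_singleton_iff, Nat.cast_inj, Set.mem_sdiff, Set.mem_Iic, Nat.cast_le]
        omega
  have htop : MeasurableSet[m] {(⊤ : ℕ∞)} := by
    have : ({⊤} : Set ℕ∞) = (⋃ n : ℕ, {(n : ℕ∞)})ᶜ := by
      ext x
      cases x <;> simp
    rw [this]
    exact (MeasurableSet.iUnion hfin).compl
  intro s _
  rw [← Set.biUnion_of_singleton s]
  refine MeasurableSet.biUnion s.to_countable fun x _ => ?_
  cases x with
  | top => exact htop
  | coe x => exact hfin x

lemma measurable_pointCount {Ω : Type*} [MeasurableSpace Ω] {ξ : ℕ → Ω → E}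
    (hξ : ∀ i, Measurable (ξ i)) {B : Set E} (hB : MeasurableSet B) :
    Measurable (pointCount ξ B) := by
  have h := ENat.generateFrom_Iic_natCast
  intro s hs
  refine @measurable_generateFrom _ _ _ {s : Set ℕ∞ | ∃ n : ℕ, s = Set.Iic (n : ℕ∞)} _ ?_ s
    (h ▸ trivial)
  rintro _ ⟨n, rfl⟩
  exact measurableSet_pointCount_le hξ hB n

/-- Existence of Poisson point processes whose intensity is a sum of probability measures. -/
theorem exists_isPoissonPointProcess (μ : ℕ → Measure E) [∀ k, IsProbabilityMeasure (μ k)] :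
    ∃ R : Measure (ℕ → E), IsProbabilityMeasure R ∧
      IsPoissonPointProcess (fun i (r : ℕ → E) => r i) (Measure.sum μ) R := by
  set R : Measure (ℕ → E) := (clustersLaw μ).map clusterPoints with hR
  have hprob : IsProbabilityMeasure R :=
    Measure.isProbabilityMeasure_map measurable_clusterPoints.aemeasurable
  have hcoord : ∀ i, Measurable fun r : ℕ → E => r i := fun i => measurable_pi_apply i
  have hmeas : ∀ {B : Set E}, MeasurableSet B →
      Measurable (pointCount (fun i (r : ℕ → E) => r i) B) := fun hB =>
    measurable_pointCount hcoord hB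
  have hjoint : ∀ {m : ℕ} (s : Finset (Fin m)) (B : Fin m → Set E),
      (∀ l, MeasurableSet (B l)) → ∀ n : Fin m → ℕ,
      R (⋂ l ∈ s, {r | pointCount (fun i (r : ℕ → E) => r i) (B l) r ≤ n l}) =
        clustersLaw μ {ω | ∀ (l : s) K, partialCount (B l) K ω ≤ n l} := by
    intro m s B hB n
    rw [hR, Measure.map_apply measurable_clusterPoints
      (Finset.measurableSet_biInter s fun l _ => measurableSet_pointCount_le hcoord (hB l) (n l))]
    refine measure_congr ?_
    filter_upwards [ae_infinite_isPointIndex μ] with ω hω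
    apply propext
    have : ∀ l, pointCount (fun i (r : ℕ → E) => r i) (B l) (clusterPoints ω) ≤ n l ↔
        ∀ K, partialCount (B l) K ω ≤ n l := fun l => by
      rw [← encard_le_iff_partialCount_le, ← pointCount_clusterPoints hω]
      rfl
    change clusterPoints ω ∈ _ ↔ ∀ (l : s) K, partialCount (B l) K ω ≤ n l
    simp [this]
  have hsingle : ∀ {B : Set E}, MeasurableSet B → ∀ n : ℕ,
      R {r | pointCount (fun i (r : ℕ → E) => r i) B r ≤ n} =
        clustersLaw μ {ω | ∀ K, partialCount B K ω ≤ n} := by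
    intro B hB n
    have := hjoint (m := 1) {0} (fun _ => B) (fun _ => hB) fun _ => n
    simpa using this
  refine ⟨R, hprob, hcoord, ?_, ?_⟩
  · intro B hB hfin k
    have hle : ∀ n : ℕ, R {r | pointCount (fun i (r : ℕ → E) => r i) B r ≤ n} =
        poissonMeasure (Measure.sum μ B).toNNReal (Set.Iic n) := fun n => by
      rw [hsingle hB, measure_forall_partialCount_le μ hB hfin]
    cases k with
    | zero =>
      convert hle 0 using 2
      · ext r; simp
      · ext x; simp
    | succ k =>
      -- Only lower tails are known so far; the mass at k + 1 is a difference of two consecutive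
      -- ones.
      have h1 : {r | pointCount (fun i (r : ℕ → E) => r i) B r = ((k + 1 : ℕ) : ℕ∞)} =
          {r | pointCount (fun i (r : ℕ → E) => r i) B r ≤ ((k + 1 : ℕ) : ℕ∞)} \
            {r | pointCount (fun i (r : ℕ → E) => r i) B r ≤ (k : ℕ∞)} := by
        ext r
        simp only [Set.mem_ofPred_eq, Set.mem_sdiff]
        generalize pointCount (fun i (r : ℕ → E) => r i) B r = x
        cases x with
        | top => simp [-Nat.cast_add, (ENat.natCast_ne_top (k + 1)).symm]
        | coe x => simp only [Nat.cast_inj, Nat.cast_le]; omega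
      have h2 : ({k + 1} : Set ℕ) = Set.Iic (k + 1) \ Set.Iic k := by
        ext x
        simp only [Set.mem_singleton_iff, Set.mem_sdiff, Set.mem_Iic]; omega
      have h3 : {r | pointCount (fun i (r : ℕ → E) => r i) B r ≤ (k : ℕ∞)} ⊆
          {r | pointCount (fun i (r : ℕ → E) => r i) B r ≤ ((k + 1 : ℕ) : ℕ∞)} := fun r hr =>
        le_trans (Set.mem_ofPred_eq ▸ hr) (Nat.cast_le.2 (Nat.le_succ k))
      rw [h1, h2, measure_sdiff h3
        (measurableSet_pointCount_le hcoord hB k).nullMeasurableSet (measure_ne_top _ _), hle, hle,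
        measure_sdiff (Set.Iic_subset_Iic.2 (Nat.le_succ k))
          (MeasurableSet.of_discrete).nullMeasurableSet (measure_ne_top _ _)]
  · intro m B hB hd
    rw [iIndepFun_iff_iIndep]
    -- Independence is checked on the π-systems of lower-tail events, where it is the product
    -- formula for clusters.
    refine iIndepSets.iIndep (fun l => (hmeas (hB l)).comap_le)
      (fun l => {s | ∃ n : ℕ, s = {r | pointCount (fun i (r : ℕ → E) => r i) (B l) r ≤ n}})
      ?_ ?_ ?_
    · rintro l _ ⟨a, rfl⟩ _ ⟨b, rfl⟩ _
      refine ⟨min a b, ?_⟩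
      ext r
      rw [(Nat.mono_cast (α := ℕ∞)).map_min]
      simp only [Set.mem_inter_iff, Set.mem_ofPred_eq, le_min_iff]
    · intro l
      have : (ENat.instMeasurableSpace) = (⊤ : MeasurableSpace ℕ∞) := rfl
      rw [this, ENat.generateFrom_Iic_natCast, MeasurableSpace.comap_generateFrom]
      congr 1
      ext s
      constructor
      · rintro ⟨_, ⟨n, rfl⟩, rfl⟩
        exact ⟨n, rfl⟩
      · rintro ⟨n, rfl⟩
        exact ⟨_, ⟨n, rfl⟩, rfl⟩
    · rw [iIndepSets_iff]
      intro s f hf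
      choose! n hn using hf
      have h1 : (⋂ l ∈ s, f l) =
          ⋂ l ∈ s, {r | pointCount (fun i (r : ℕ → E) => r i) (B l) r ≤ n l} :=
        Set.iInter₂_congr fun l hl => hn l hl
      rw [h1, hjoint s B hB n, measure_forall_partialCount_le_prod (ι := s) μ (fun l => hB l)
        (fun l l' h => hd l l' fun h' => h (Subtype.ext h')) (fun l => n l)]
      rw [Finset.prod_coe_sort s fun l => clustersLaw μ {ω | ∀ K, partialCount (B l) K ω ≤ n l}]
      refine Finset.prod_congr rfl fun l hl => ?_
      rw [hn l hl, hsingle (hB l)]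

end PoissonEnumeration

/-! ### The earliest point of a Poisson process in a region -/

section FirstPoint

variable {H : Type*}

/-- The set of points whose position lies in `U` and whose time lies in `T`. -/
def timeBox (U : Set (H × ℝ)) (T : Set ℝ) : Set (H × ℝ × ℝ) :=
  {x | (x.1, x.2.1) ∈ U ∧ x.2.2 ∈ T}

/-- The `j`-th point is the strictly earliest one among the points with position in `U`. -/
def IsFirstPoint (U : Set (H × ℝ)) (r : ℕ → H × ℝ × ℝ) (j : ℕ) : Prop :=
  ((r j).1, (r j).2.1) ∈ U ∧
    ∀ i, i ≠ j → ((r i).1, (r i).2.1) ∈ U → (r j).2.2 < (r i).2.2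

lemma IsFirstPoint.unique {U : Set (H × ℝ)} {r : ℕ → H × ℝ × ℝ} {i j : ℕ}
    (hi : IsFirstPoint U r i) (hj : IsFirstPoint U r j) : i = j := by
  by_contra h
  exact lt_asymm (hi.2 j (Ne.symm h) hj.1) (hj.2 i h hi.1)

lemma IsFirstPoint.mono {U U' : Set (H × ℝ)} (hU : U ⊆ U') {r : ℕ → H × ℝ × ℝ} {j : ℕ}
    (hj : IsFirstPoint U' r j) (hmem : ((r j).1, (r j).2.1) ∈ U) : IsFirstPoint U r j :=
  ⟨hmem, fun i hi hiU => hj.2 i hi (hU hiU)⟩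

/-- The first point of `U` comes in the `a`-th time interval of length `δ`, is the only one there,
and lies in `V`. -/
def firstInSlot (U V : Set (H × ℝ)) (δ : ℝ) (a : ℕ) : Set (ℕ → H × ℝ × ℝ) :=
  {r | pointCount (fun i (r : ℕ → H × ℝ × ℝ) => r i) (timeBox U (Set.Iio (a * δ))) r = (0 : ℕ) ∧
    pointCount (fun i (r : ℕ → H × ℝ × ℝ) => r i)
      (timeBox V (Set.Ico (a * δ) ((a + 1) * δ))) r = (1 : ℕ) ∧
    pointCount (fun i (r : ℕ → H × ℝ × ℝ) => r i)
      (timeBox (U \ V) (Set.Ico (a * δ) ((a + 1) * δ))) r = (0 : ℕ)}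

lemma exists_of_mem_firstInSlot {U V : Set (H × ℝ)} (hVU : V ⊆ U) {δ : ℝ} {a : ℕ}
    {r : ℕ → H × ℝ × ℝ} (hr : r ∈ firstInSlot U V δ a) :
    (∀ i, ((r i).1, (r i).2.1) ∈ U → a * δ ≤ (r i).2.2) ∧
      ∃ j, IsFirstPoint U r j ∧ ((r j).1, (r j).2.1) ∈ V ∧ (r j).2.2 < (a + 1) * δ := by
  obtain ⟨h0, h1, h2⟩ := hr
  simp only [pointCount, Nat.cast_zero, Set.encard_eq_zero, Set.eq_empty_iff_forall_notMem,
    Set.mem_ofPred_eq, timeBox, Set.mem_Iio, not_and, not_lt] at h0 h2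
  simp only [pointCount, Nat.cast_one, Set.encard_eq_one] at h1
  obtain ⟨j, hj⟩ := h1
  have hj' : j ∈ {i : ℕ | r i ∈ timeBox V (Set.Ico (a * δ) ((a + 1) * δ))} := by
    rw [hj]; rfl
  obtain ⟨hjV, hjt⟩ := hj'
  refine ⟨h0, j, ⟨hVU hjV, fun i hij hiU => ?_⟩, hjV, hjt.2⟩
  by_contra! hle
  have hit : (r i).2.2 ∈ Set.Ico (a * δ) ((a + 1) * δ) := ⟨h0 i hiU, hle.trans_lt hjt.2⟩
  by_cases hiV : ((r i).1, (r i).2.1) ∈ V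
  · have : i ∈ {i : ℕ | r i ∈ timeBox V (Set.Ico (a * δ) ((a + 1) * δ))} := ⟨hiV, hit⟩
    rw [hj] at this
    exact hij this
  · exact h2 i ⟨hiU, hiV⟩ hit

variable [MeasurableSpace H]

lemma lebNonneg_Iio {a : ℝ} : lebNonneg (Set.Iio a) = ENNReal.ofReal a := by
  rw [Measure.restrict_apply measurableSet_Iio, Set.inter_comm, Set.Ici_inter_Iio,
    Real.volume_Ico, sub_zero]

lemma lebNonneg_Ico {a b : ℝ} (ha : 0 ≤ a) :
    lebNonneg (Set.Ico a b) = ENNReal.ofReal (b - a) := by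
  rw [Measure.restrict_apply measurableSet_Ico, Set.inter_eq_left.2, Real.volume_Ico]
  exact fun x hx => ha.trans hx.1

/-- Cut the quadrant of heights and times into unit squares, indexed by one natural number through
the pairing function. -/
lemma exists_sum_eq_prod_lebNonneg (P : Measure H) [IsProbabilityMeasure P] :
    ∃ μ : ℕ → Measure (H × ℝ × ℝ), (∀ k, IsProbabilityMeasure (μ k)) ∧
      Measure.sum μ = P.prod (lebNonneg.prod lebNonneg) := by
  set ν : ℕ → Measure ℝ := fun n => volume.restrict (Set.Ico (n : ℝ) (n + 1)) with hν
  have hprob : ∀ n, IsProbabilityMeasure (ν n) := fun n => ⟨by simp [hν]⟩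
  have hsum : lebNonneg = Measure.sum ν := by
    rw [hν, ← Measure.restrict_iUnion _ fun n => measurableSet_Ico]
    · have : Set.Ici (0 : ℝ) = ⋃ n : ℕ, Set.Ico (n : ℝ) (n + 1) := by
        ext x
        simp only [Set.mem_Ici, Set.mem_iUnion, Set.mem_Ico]
        constructor
        · intro hx
          exact ⟨⌊x⌋₊, Nat.floor_le hx, Nat.lt_floor_add_one x⟩
        · rintro ⟨n, hn, _⟩
          exact n.cast_nonneg.trans hn
      rw [lebNonneg, this]
    · intro m n hmn
      rw [Function.onFun, Set.disjoint_left]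
      rintro x ⟨h1, h2⟩ ⟨h3, h4⟩
      apply hmn
      have h5 : (m : ℝ) < n + 1 := h1.trans_lt h4
      have h6 : (n : ℝ) < m + 1 := h3.trans_lt h2
      norm_cast at h5 h6
      omega
  refine ⟨fun k => P.prod ((ν k.unpair.1).prod (ν k.unpair.2)), fun k => inferInstance, ?_⟩
  rw [hsum, Measure.prod_sum, Measure.prod_sum_right]
  ext s hs
  rw [Measure.sum_apply _ hs, Measure.sum_apply _ hs]
  exact Nat.pairEquiv.symm.tsum_eq fun p : ℕ × ℕ => (P.prod ((ν p.1).prod (ν p.2))) s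

lemma measurableSet_timeBox {U : Set (H × ℝ)} (hU : MeasurableSet U) {T : Set ℝ}
    (hT : MeasurableSet T) : MeasurableSet (timeBox U T) :=
  (MeasurableEquiv.prodAssoc.symm.measurable) (hU.prod hT)

lemma prod_timeBox (P : Measure H) [IsProbabilityMeasure P] {U : Set (H × ℝ)}
    (hU : MeasurableSet U) {T : Set ℝ} (hT : MeasurableSet T) :
    P.prod (lebNonneg.prod lebNonneg) (timeBox U T) = P.prod lebNonneg U * lebNonneg T := by
  have h := (measurePreserving_prodAssoc P lebNonneg lebNonneg).measure_preimage
    (measurableSet_timeBox hU hT).nullMeasurableSet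
  rw [← h, ← Measure.prod_prod]
  rfl

lemma IsPoissonPointProcess.measure_pointCount_eq {Ω E : Type*} [MeasurableSpace Ω]
    [MeasurableSpace E] {ξ : ℕ → Ω → E} {Λ : Measure E} {R : Measure Ω}
    (h : IsPoissonPointProcess ξ Λ R) {B : Set E} (hB : MeasurableSet B) {c : ℝ} (hc : 0 ≤ c)
    (hΛ : Λ B = ENNReal.ofReal c) (k : ℕ) :
    R {ω | pointCount ξ B ω = k} = ENNReal.ofReal (Real.exp (-c) * c ^ k / k.factorial) := by
  rw [h.count_law B hB (by simp [hΛ]), poissonMeasure_singleton, hΛ,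
    ENNReal.coe_toNNReal_eq_toReal, ENNReal.toReal_ofReal hc]

lemma IsPoissonPointProcess.ae_notMem {Ω E : Type*} [MeasurableSpace Ω]
    [MeasurableSpace E] {ξ : ℕ → Ω → E} {Λ : Measure E} {R : Measure Ω} [IsProbabilityMeasure R]
    (h : IsPoissonPointProcess ξ Λ R) {B : Set E} (hB : MeasurableSet B) (hΛ : Λ B = 0) :
    ∀ᵐ ω ∂(R), ∀ i, ξ i ω ∉ B := by
  have h1 := h.measure_pointCount_eq hB le_rfl (by simpa using hΛ) 0
  have hset : {ω | pointCount ξ B ω = (0 : ℕ)} = {ω | ∀ i, ξ i ω ∉ B} := by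
    ext ω
    simp [pointCount, Set.eq_empty_iff_forall_notMem]
  have hm : MeasurableSet {ω | ∀ i, ξ i ω ∉ B} := by
    have : {ω | ∀ i, ξ i ω ∉ B} = ⋂ i, (ξ i ⁻¹' B)ᶜ := by ext; simp
    rw [this]
    exact MeasurableSet.iInter fun i => (h.measurable i hB).compl
  rw [hset] at h1
  exact (mem_ae_iff_prob_eq_one hm).2 (by simpa using h1)

/-- The region may depend on a parameter; with the sample as parameter this yields the joint
measurability used for the product-space bound. -/
lemma measurableSet_isFirstPoint_parametric {Ω' : Type*} [MeasurableSpace Ω']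
    {U : Ω' → Set (H × ℝ)} (hU : MeasurableSet {p : Ω' × H × ℝ | p.2 ∈ U p.1}) (j : ℕ) :
    MeasurableSet {p : Ω' × (ℕ → H × ℝ × ℝ) | IsFirstPoint (U p.1) p.2 j} := by
  have hmem : ∀ i, MeasurableSet
      {p : Ω' × (ℕ → H × ℝ × ℝ) | ((p.2 i).1, (p.2 i).2.1) ∈ U p.1} := by
    intro i
    have : Measurable fun p : Ω' × (ℕ → H × ℝ × ℝ) => (p.1, (p.2 i).1, (p.2 i).2.1) := by
      fun_prop
    exact this hU
  have hlt : ∀ i, MeasurableSet {p : Ω' × (ℕ → H × ℝ × ℝ) | (p.2 j).2.2 < (p.2 i).2.2} :=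
    fun i => measurableSet_lt (by fun_prop) (by fun_prop)
  have : {p : Ω' × (ℕ → H × ℝ × ℝ) | IsFirstPoint (U p.1) p.2 j} =
      {p | ((p.2 j).1, (p.2 j).2.1) ∈ U p.1} ∩ ⋂ (i : ℕ) (_ : i ≠ j),
        ({p | ((p.2 i).1, (p.2 i).2.1) ∈ U p.1}ᶜ ∪ {p | (p.2 j).2.2 < (p.2 i).2.2}) := by
    ext p
    simp only [IsFirstPoint, Set.mem_ofPred_eq, Set.mem_inter_iff, Set.mem_iInter, Set.mem_union,
      Set.mem_compl_iff, imp_iff_not_or]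
  rw [this]
  exact (hmem j).inter (MeasurableSet.iInter fun i => MeasurableSet.iInter fun _ =>
    (hmem i).compl.union (hlt i))

lemma measurableSet_isFirstPoint {U : Set (H × ℝ)} (hU : MeasurableSet U) (j : ℕ) :
    MeasurableSet {r : ℕ → H × ℝ × ℝ | IsFirstPoint U r j} := by
  have h := measurableSet_isFirstPoint_parametric (Ω' := Unit) (U := fun _ => U)
    (measurable_snd hU) j
  exact (measurable_prodMk_left (x := ())) h

lemma measurableSet_exists_isFirstPoint {U V : Set (H × ℝ)} (hU : MeasurableSet U)
    (hV : MeasurableSet V) :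
    MeasurableSet {r : ℕ → H × ℝ × ℝ |
      ∃ j, IsFirstPoint U r j ∧ ((r j).1, (r j).2.1) ∈ V} := by
  have : {r : ℕ → H × ℝ × ℝ | ∃ j, IsFirstPoint U r j ∧ ((r j).1, (r j).2.1) ∈ V} =
      ⋃ j, ({r | IsFirstPoint U r j} ∩ (fun r => ((r j).1, (r j).2.1)) ⁻¹' V) := by
    ext; simp
  rw [this]
  refine MeasurableSet.iUnion fun j => (measurableSet_isFirstPoint hU j).inter ?_
  have : Measurable fun r : ℕ → H × ℝ × ℝ => ((r j).1, (r j).2.1) := by fun_prop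
  exact this hV

variable {P : Measure H} [IsProbabilityMeasure P] {R : Measure (ℕ → H × ℝ × ℝ)}

/-- The three boxes are disjoint, so the probability is the product of exp(-u a δ), v δ exp(-v δ)
and exp(-(u - v) δ). -/
lemma measure_firstInSlot (hR : IsPoissonPointProcess (fun i (r : ℕ → H × ℝ × ℝ) => r i)
      (P.prod (lebNonneg.prod lebNonneg)) R)
    {U V : Set (H × ℝ)} (hU : MeasurableSet U) (hV : MeasurableSet V) (hVU : V ⊆ U) {u v : ℝ}
    (hv : 0 ≤ v) (hvu : v ≤ u) (hUu : P.prod lebNonneg U = ENNReal.ofReal u)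
    (hVv : P.prod lebNonneg V = ENNReal.ofReal v) {δ : ℝ} (hδ : 0 < δ) (a : ℕ) :
    R (firstInSlot U V δ a) =
      ENNReal.ofReal (v * δ * Real.exp (-(u * δ)) * Real.exp (-(u * δ)) ^ a) := by
  have hWw : P.prod lebNonneg (U \ V) = ENNReal.ofReal (u - v) := by
    rw [measure_sdiff hVU hV.nullMeasurableSet (by simp [hVv]), hUu, hVv, ENNReal.ofReal_sub _ hv]
  let B : Fin 3 → Set (H × ℝ × ℝ) := ![timeBox U (Set.Iio (a * δ)),
    timeBox V (Set.Ico (a * δ) ((a + 1) * δ)), timeBox (U \ V) (Set.Ico (a * δ) ((a + 1) * δ))]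
  have hB : ∀ l, MeasurableSet (B l) := by
    intro l
    fin_cases l
    · exact measurableSet_timeBox hU measurableSet_Iio
    · exact measurableSet_timeBox hV measurableSet_Ico
    · exact measurableSet_timeBox (hU.diff hV) measurableSet_Ico
  have h01 : Disjoint (B 0) (B 1) := Set.disjoint_left.2 fun x hx hx' =>
    absurd hx.2 (not_lt.2 hx'.2.1)
  have h02 : Disjoint (B 0) (B 2) := Set.disjoint_left.2 fun x hx hx' =>
    absurd hx.2 (not_lt.2 hx'.2.1)
  have h12 : Disjoint (B 1) (B 2) := Set.disjoint_left.2 fun x hx hx' => hx'.1.2 hx.1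
  have hd : ∀ l l', l ≠ l' → Disjoint (B l) (B l') := by
    intro l l' hl
    fin_cases l <;> fin_cases l' <;> first
      | exact absurd rfl hl
      | assumption
      | exact h01.symm
      | exact h02.symm
      | exact h12.symm
  have hind := (hR.count_indep 3 B hB hd).measure_inter_preimage_eq_mul Finset.univ
    (sets := ![{((0 : ℕ) : ℕ∞)}, {((1 : ℕ) : ℕ∞)}, {((0 : ℕ) : ℕ∞)}]) fun _ _ => .of_discrete
  rw [Fin.prod_univ_three] at hind
  have hset : firstInSlot U V δ a = ⋂ l ∈ (Finset.univ : Finset (Fin 3)),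
      pointCount (fun i (r : ℕ → H × ℝ × ℝ) => r i) (B l) ⁻¹'
        (![{((0 : ℕ) : ℕ∞)}, {((1 : ℕ) : ℕ∞)}, {((0 : ℕ) : ℕ∞)}] : Fin 3 → Set ℕ∞) l := by
    ext r
    simp only [Finset.mem_univ, Set.iInter_true, Set.mem_iInter, Fin.forall_fin_succ,
      firstInSlot, B]
    simp
  have haδ : 0 ≤ a * δ := by positivity
  have hlen : (a + 1) * δ - a * δ = δ := by ring
  have e0 : R (pointCount (fun i (r : ℕ → H × ℝ × ℝ) => r i) (B 0) ⁻¹' {((0 : ℕ) : ℕ∞)}) = _ :=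
    hR.measure_pointCount_eq (hB 0) (c := u * (a * δ)) (by nlinarith) (by
      change P.prod _ (timeBox _ _) = _
      rw [prod_timeBox P hU measurableSet_Iio, hUu, lebNonneg_Iio,
        ENNReal.ofReal_mul (hv.trans hvu)]) 0
  have e1 : R (pointCount (fun i (r : ℕ → H × ℝ × ℝ) => r i) (B 1) ⁻¹' {((1 : ℕ) : ℕ∞)}) = _ :=
    hR.measure_pointCount_eq (hB 1) (c := v * δ) (by positivity) (by
      change P.prod _ (timeBox _ _) = _
      rw [prod_timeBox P hV measurableSet_Ico, hVv, lebNonneg_Ico haδ, hlen,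
        ENNReal.ofReal_mul hv]) 1
  have e2 : R (pointCount (fun i (r : ℕ → H × ℝ × ℝ) => r i) (B 2) ⁻¹' {((0 : ℕ) : ℕ∞)}) = _ :=
    hR.measure_pointCount_eq (hB 2) (c := (u - v) * δ) (by nlinarith) (by
      change P.prod _ (timeBox _ _) = _
      rw [prod_timeBox P (hU.diff hV) measurableSet_Ico, hWw, lebNonneg_Ico haδ, hlen,
        ENNReal.ofReal_mul (sub_nonneg.2 hvu)]) 0
  rw [hset, hind]
  simp only [Matrix.cons_val_zero, Matrix.cons_val_one, Matrix.cons_val]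
  rw [e0, e1, e2, ← ENNReal.ofReal_mul (by positivity), ← ENNReal.ofReal_mul (by positivity)]
  congr 1
  rw [← Real.exp_nat_mul]
  simp only [pow_zero, pow_one, Nat.factorial, Nat.cast_one, mul_one, div_one]
  have : Real.exp (-(u * δ)) = Real.exp (-(v * δ)) * Real.exp (-((u - v) * δ)) := by
    rw [← Real.exp_add]; ring_nf
  rw [this, show (a : ℝ) * -(u * δ) = -(u * (a * δ)) by ring]
  ring

/-- Slots give disjoint events whose probabilities sum to v δ q / (1 - q) with q = exp(-u δ). Since
1 - q ≤ u δ, this is at least (v / u) q, and q → 1 as δ → 0. -/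
lemma ofReal_div_le_measure_isFirstPoint
    (hR : IsPoissonPointProcess (fun i (r : ℕ → H × ℝ × ℝ) => r i)
      (P.prod (lebNonneg.prod lebNonneg)) R)
    {U V : Set (H × ℝ)} (hU : MeasurableSet U) (hV : MeasurableSet V) (hVU : V ⊆ U) {u v : ℝ}
    (hv : 0 ≤ v) (hvu : v ≤ u) (hu : 0 < u) (hUu : P.prod lebNonneg U = ENNReal.ofReal u)
    (hVv : P.prod lebNonneg V = ENNReal.ofReal v) :
    ENNReal.ofReal (v / u) ≤ R {r | ∃ j, IsFirstPoint U r j ∧ ((r j).1, (r j).2.1) ∈ V} := by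
  have hδ : ∀ δ : ℝ, 0 < δ → ENNReal.ofReal (v / u * Real.exp (-(u * δ))) ≤
      R {r | ∃ j, IsFirstPoint U r j ∧ ((r j).1, (r j).2.1) ∈ V} := by
    intro δ hδ
    have hsub : (⋃ a, firstInSlot U V δ a) ⊆
        {r | ∃ j, IsFirstPoint U r j ∧ ((r j).1, (r j).2.1) ∈ V} := by
      refine Set.iUnion_subset fun a r hr => ?_
      obtain ⟨-, j, h1, h2, -⟩ := exists_of_mem_firstInSlot hVU hr
      exact ⟨j, h1, h2⟩
    have hlt : ∀ a b : ℕ, a < b → ∀ r, r ∈ firstInSlot U V δ a → r ∉ firstInSlot U V δ b := by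
      intro a b hab r ha hb
      obtain ⟨-, j, h1, h2, h3⟩ := exists_of_mem_firstInSlot hVU ha
      have h4 := (exists_of_mem_firstInSlot hVU hb).1 j h1.1
      have h5 : ((a : ℝ) + 1) * δ ≤ b * δ :=
        mul_le_mul_of_nonneg_right (by exact_mod_cast hab) hδ.le
      linarith
    have hdisj : Pairwise (Function.onFun Disjoint fun a => firstInSlot U V δ a) := by
      intro a b hab
      rw [Function.onFun, Set.disjoint_left]
      rcases lt_or_gt_of_ne hab with h | h
      · exact fun r => hlt a b h r
      · exact fun r ha hb => hlt b a h r hb ha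
    have hm : ∀ a, MeasurableSet (firstInSlot U V δ a) := by
      intro a
      have hc : ∀ i, Measurable fun r : ℕ → H × ℝ × ℝ => r i := fun i => measurable_pi_apply i
      refine (measurable_pointCount hc (measurableSet_timeBox hU measurableSet_Iio)
        (t := {((0 : ℕ) : ℕ∞)}) .of_discrete).inter
        ((measurable_pointCount hc (measurableSet_timeBox hV measurableSet_Ico)
          (t := {((1 : ℕ) : ℕ∞)}) .of_discrete).inter
        (measurable_pointCount hc (measurableSet_timeBox (hU.diff hV) measurableSet_Ico)
          (t := {((0 : ℕ) : ℕ∞)}) .of_discrete))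
    refine le_trans ?_ (measure_mono hsub)
    rw [measure_iUnion hdisj hm]
    simp only [measure_firstInSlot hR hU hV hVU hv hvu hUu hVv hδ]
    set q := Real.exp (-(u * δ)) with hq
    have hq0 : 0 < q := Real.exp_pos _
    have hq1 : q < 1 := Real.exp_lt_one_iff.2 (neg_lt_zero.2 (by positivity))
    rw [← ENNReal.ofReal_tsum_of_nonneg (fun a => by positivity)
      ((summable_geometric_of_lt_one hq0.le hq1).mul_left _), tsum_mul_left,
      tsum_geometric_of_lt_one hq0.le hq1]
    refine ENNReal.ofReal_le_ofReal ?_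
    have h1 : 1 - q ≤ u * δ := by
      have := Real.add_one_le_exp (-(u * δ))
      linarith
    have h2 : (u * δ)⁻¹ ≤ (1 - q)⁻¹ := inv_anti₀ (by linarith) h1
    calc v / u * q = v * δ * q * (u * δ)⁻¹ := by field_simp
      _ ≤ v * δ * q * (1 - q)⁻¹ := by gcongr
  have hlim : Tendsto (fun δ : ℝ => ENNReal.ofReal (v / u * Real.exp (-(u * δ)))) (𝓝[>] 0)
      (𝓝 (ENNReal.ofReal (v / u))) := by
    have : Continuous fun δ : ℝ => ENNReal.ofReal (v / u * Real.exp (-(u * δ))) :=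
      ENNReal.continuous_ofReal.comp (by fun_prop)
    have h := (this.tendsto 0).mono_left (nhdsWithin_le_nhds (s := Set.Ioi (0 : ℝ)))
    simpa using h
  exact le_of_tendsto hlim (eventually_nhdsWithin_of_forall fun δ h => hδ δ h)

variable [IsProbabilityMeasure R]

/-- The position of the earliest point in `U` is distributed according to the normalized
restriction of the intensity to `U`. -/
theorem measure_isFirstPoint (hR : IsPoissonPointProcess (fun i (r : ℕ → H × ℝ × ℝ) => r i)
      (P.prod (lebNonneg.prod lebNonneg)) R)
    {U V : Set (H × ℝ)} (hU : MeasurableSet U) (hV : MeasurableSet V) (hVU : V ⊆ U) {u v : ℝ}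
    (hv : 0 ≤ v) (hvu : v ≤ u) (hu : 0 < u) (hUu : P.prod lebNonneg U = ENNReal.ofReal u)
    (hVv : P.prod lebNonneg V = ENNReal.ofReal v) :
    R {r | ∃ j, IsFirstPoint U r j ∧ ((r j).1, (r j).2.1) ∈ V} = ENNReal.ofReal (v / u) := by
  refine le_antisymm ?_ (ofReal_div_le_measure_isFirstPoint hR hU hV hVU hv hvu hu hUu hVv)
  -- The lower bound applied to the complement `U \ V` becomes an upper bound for `V`, because the
  -- earliest point is unique.
  have hWw : P.prod lebNonneg (U \ V) = ENNReal.ofReal (u - v) := by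
    rw [measure_sdiff hVU hV.nullMeasurableSet (by simp [hVv]), hUu, hVv, ENNReal.ofReal_sub _ hv]
  have hW := ofReal_div_le_measure_isFirstPoint hR hU (hU.diff hV) Set.sdiff_subset
    (sub_nonneg.2 hvu) (sub_le_self _ hv) hu hUu hWw
  have hsub : {r | ∃ j, IsFirstPoint U r j ∧ ((r j).1, (r j).2.1) ∈ V} ⊆
      {r : ℕ → H × ℝ × ℝ | ∃ j, IsFirstPoint U r j ∧ ((r j).1, (r j).2.1) ∈ U \ V}ᶜ := by
    rintro r ⟨j, hj, hjV⟩ ⟨i, hi, hiV⟩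
    rw [hi.unique hj] at hiV
    exact hiV.2 hjV
  calc R {r | ∃ j, IsFirstPoint U r j ∧ ((r j).1, (r j).2.1) ∈ V}
      ≤ 1 - R {r | ∃ j, IsFirstPoint U r j ∧ ((r j).1, (r j).2.1) ∈ U \ V} := by
        rw [← prob_compl_eq_one_sub (measurableSet_exists_isFirstPoint hU (hU.diff hV))]
        exact measure_mono hsub
    _ ≤ 1 - ENNReal.ofReal ((u - v) / u) := tsub_le_tsub_left hW _
    _ = ENNReal.ofReal (v / u) := by
        rw [← ENNReal.ofReal_one, ← ENNReal.ofReal_sub _ (div_nonneg (sub_nonneg.2 hvu) hu.le)]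
        congr 1
        field_simp
        ring

end FirstPoint

/-! ### Rejection sampling and the coupling bound -/

section RejectionSampling

variable {H : Type*}

/-- The region under the graph of `f`. -/
def acceptRegion (f : H → ℝ≥0∞) : Set (H × ℝ) :=
  {p | ENNReal.ofReal p.2 < f p.1}

open Classical in
/-- The index of the earliest point in `U` (and `0` if there is none). -/
def firstIndex (U : Set (H × ℝ)) (r : ℕ → H × ℝ × ℝ) : ℕ :=
  if h : ∃ j, IsFirstPoint U r j then h.choose else 0

lemma IsFirstPoint.firstIndex_eq {U : Set (H × ℝ)} {r : ℕ → H × ℝ × ℝ} {j : ℕ}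
    (hj : IsFirstPoint U r j) : firstIndex U r = j := by
  have h : ∃ j, IsFirstPoint U r j := ⟨j, hj⟩
  rw [firstIndex, dif_pos h]
  exact h.choose_spec.unique hj

/-- Rejection sampling: the mark of the earliest point under the graph of `f`. -/
def rejectionSample (f : H → ℝ≥0∞) (r : ℕ → H × ℝ × ℝ) : H :=
  (r (firstIndex (acceptRegion f) r)).1

lemma inter_acceptRegion (f g : H → ℝ≥0∞) :
    acceptRegion f ∩ acceptRegion g = acceptRegion fun h => min (f h) (g h) := by
  ext p
  simp [acceptRegion]

lemma union_acceptRegion (f g : H → ℝ≥0∞) :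
    acceptRegion f ∪ acceptRegion g = acceptRegion fun h => max (f h) (g h) := by
  ext p
  simp [acceptRegion]

variable [MeasurableSpace H]

lemma measurableSet_acceptRegion {f : H → ℝ≥0∞} (hf : Measurable f) :
    MeasurableSet (acceptRegion f) :=
  measurableSet_lt (ENNReal.measurable_ofReal.comp measurable_snd) (hf.comp measurable_fst)

lemma lebNonneg_ofReal_lt (c : ℝ≥0∞) : lebNonneg {y | ENNReal.ofReal y < c} = c := by
  rcases eq_or_ne c ∞ with rfl | hc
  · simp
  · rcases eq_or_ne c 0 with rfl | hc0
    · simp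
    · have : {y : ℝ | ENNReal.ofReal y < c} = Set.Iio c.toReal := by
        ext y
        simp only [Set.mem_ofPred_eq, Set.mem_Iio]
        conv_lhs => rw [← ENNReal.ofReal_toReal hc]
        exact ENNReal.ofReal_lt_ofReal_iff (ENNReal.toReal_pos hc0 hc)
      rw [this, lebNonneg_Iio, ENNReal.ofReal_toReal hc]

lemma prod_acceptRegion_inter (P : Measure H) [IsProbabilityMeasure P] {f : H → ℝ≥0∞}
    (hf : Measurable f) {B : Set H} (hB : MeasurableSet B) :
    P.prod lebNonneg (acceptRegion f ∩ Prod.fst ⁻¹' B) = ∫⁻ h in B, f h ∂P := by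
  rw [Measure.prod_apply ((measurableSet_acceptRegion hf).inter (measurable_fst hB)),
    ← lintegral_indicator hB]
  refine lintegral_congr fun h => ?_
  by_cases hh : h ∈ B
  · rw [Set.indicator_of_mem hh]
    refine Eq.trans ?_ (lebNonneg_ofReal_lt (f h))
    congr 1
    ext y
    simp [acceptRegion, hh]
  · rw [Set.indicator_of_notMem hh]
    refine measure_mono_null (t := ∅) ?_ measure_empty
    exact fun y hy => hh hy.2

lemma prod_acceptRegion (P : Measure H) [IsProbabilityMeasure P] {f : H → ℝ≥0∞}
    (hf : Measurable f) : P.prod lebNonneg (acceptRegion f) = ∫⁻ h, f h ∂P := by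
  simpa using prod_acceptRegion_inter P hf MeasurableSet.univ

lemma measurable_firstIndex {U : Set (H × ℝ)} (hU : MeasurableSet U) :
    Measurable (firstIndex U) := by
  have hpos : ∀ j, j ≠ 0 → MeasurableSet (firstIndex U ⁻¹' {j}) := by
    intro j hj
    have : firstIndex U ⁻¹' {j} = {r | IsFirstPoint U r j} := by
      ext r
      constructor
      · intro h
        rw [Set.mem_preimage, Set.mem_singleton_iff] at h
        by_cases hex : ∃ i, IsFirstPoint U r i
        · obtain ⟨i, hi⟩ := hex
          rw [hi.firstIndex_eq] at h
          exact h ▸ hi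
        · rw [firstIndex, dif_neg hex] at h
          exact absurd h.symm hj
      · exact fun h => h.firstIndex_eq
    rw [this]
    exact measurableSet_isFirstPoint hU j
  refine measurable_to_countable' fun j => ?_
  rcases eq_or_ne j 0 with rfl | hj
  · have : firstIndex U ⁻¹' {0} = (⋃ (j : ℕ) (_ : j ≠ 0), firstIndex U ⁻¹' {j})ᶜ := by
      ext r
      simp only [Set.mem_preimage, Set.mem_singleton_iff, Set.mem_compl_iff, Set.mem_iUnion,
        exists_prop, exists_eq_right', not_not]
    rw [this]
    exact (MeasurableSet.iUnion fun j => MeasurableSet.iUnion fun hj => hpos j hj).compl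
  · exact hpos j hj

lemma measurable_rejectionSample {f : H → ℝ≥0∞} (hf : Measurable f) :
    Measurable (rejectionSample f) := by
  have h : Measurable fun p : ℕ × (ℕ → H × ℝ × ℝ) => (p.2 p.1).1 := by
    apply measurable_from_prod_countable_right
    intro j
    exact measurable_fst.comp (measurable_pi_apply j)
  exact h.comp ((measurable_firstIndex (measurableSet_acceptRegion hf)).prodMk measurable_id)

variable {P : Measure H} [IsProbabilityMeasure P] {R : Measure (ℕ → H × ℝ × ℝ)}
  [IsProbabilityMeasure R]

lemma measure_isFirstPoint_mark (hR : IsPoissonPointProcess (fun i (r : ℕ → H × ℝ × ℝ) => r i)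
      (P.prod (lebNonneg.prod lebNonneg)) R)
    {f : H → ℝ≥0∞} (hf : Measurable f) (hf1 : ∫⁻ h, f h ∂P = 1) {B : Set H}
    (hB : MeasurableSet B) :
    R {r | ∃ j, IsFirstPoint (acceptRegion f) r j ∧ (r j).1 ∈ B} = ∫⁻ h in B, f h ∂P := by
  have hle : ∫⁻ h in B, f h ∂P ≤ 1 := hf1 ▸ setLIntegral_le_lintegral B f
  have hne : ∫⁻ h in B, f h ∂P ≠ ∞ := ne_top_of_le_ne_top ENNReal.one_ne_top hle
  have h := measure_isFirstPoint hR (measurableSet_acceptRegion hf)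
    ((measurableSet_acceptRegion hf).inter (measurable_fst hB)) Set.inter_subset_left
    (u := 1) (v := (∫⁻ h in B, f h ∂P).toReal) ENNReal.toReal_nonneg
    (ENNReal.toReal_le_of_le_ofReal zero_le_one (by simpa using hle)) one_pos
    (by rw [prod_acceptRegion P hf, hf1, ENNReal.ofReal_one])
    (by rw [prod_acceptRegion_inter P hf hB, ENNReal.ofReal_toReal hne])
  rw [div_one, ENNReal.ofReal_toReal hne] at h
  rw [← h]
  congr 1
  ext r
  refine exists_congr fun j => and_congr_right fun hj => ?_
  exact ⟨fun h => ⟨hj.1, h⟩, fun h => h.2⟩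

/-- The region under a density has mass 1, so an earliest point exists almost surely and the default
index 0 plays no role. -/
lemma ae_isFirstPoint_firstIndex
    (hR : IsPoissonPointProcess (fun i (r : ℕ → H × ℝ × ℝ) => r i)
      (P.prod (lebNonneg.prod lebNonneg)) R)
    {f : H → ℝ≥0∞} (hf : Measurable f) (hf1 : ∫⁻ h, f h ∂P = 1) :
    ∀ᵐ r ∂(R), IsFirstPoint (acceptRegion f) r (firstIndex (acceptRegion f) r) := by
  have h := measure_isFirstPoint_mark hR hf hf1 MeasurableSet.univ
  rw [Measure.restrict_univ, hf1] at h
  have hm := measurableSet_exists_isFirstPoint (measurableSet_acceptRegion hf)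
    (MeasurableSet.univ (α := H × ℝ))
  have hae := (mem_ae_iff_prob_eq_one hm).2 (by simpa using h)
  filter_upwards [hae] with r hr
  obtain ⟨j, hj, -⟩ := hr
  rwa [hj.firstIndex_eq]

theorem map_rejectionSample (hR : IsPoissonPointProcess (fun i (r : ℕ → H × ℝ × ℝ) => r i)
      (P.prod (lebNonneg.prod lebNonneg)) R)
    {f : H → ℝ≥0∞} (hf : Measurable f) (hf1 : ∫⁻ h, f h ∂P = 1) :
    R.map (rejectionSample f) = P.withDensity f := by
  ext B hB
  rw [Measure.map_apply (measurable_rejectionSample hf) hB, withDensity_apply _ hB,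
    ← measure_isFirstPoint_mark hR hf hf1 hB]
  refine measure_congr ?_
  filter_upwards [ae_isFirstPoint_firstIndex hR hf hf1] with r hr
  apply propext
  change rejectionSample f r ∈ B ↔ ∃ j, IsFirstPoint (acceptRegion f) r j ∧ (r j).1 ∈ B
  constructor
  · exact fun h => ⟨_, hr, h⟩
  · rintro ⟨j, hj, h⟩
    rwa [rejectionSample, hj.firstIndex_eq]

/-- The probability that two rejection samplers do not accept the same point is at most `2d/(1+d)`,
where `d` is the total variation distance; here this concave function is replaced by its tangent
at `ρ`. -/
theorem measure_not_exists_isFirstPoint_le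
    (hR : IsPoissonPointProcess (fun i (r : ℕ → H × ℝ × ℝ) => r i)
      (P.prod (lebNonneg.prod lebNonneg)) R)
    {f g : H → ℝ≥0∞} (hf : Measurable f) (hf1 : ∫⁻ h, f h ∂P = 1) (hg : Measurable g)
    (hg1 : ∫⁻ h, g h ∂P = 1) (ρ : ℝ≥0) :
    R {r | ¬ ∃ j, IsFirstPoint (acceptRegion f) r j ∧ IsFirstPoint (acceptRegion g) r j} ≤
      ((2 * ρ ^ 2 / (1 + ρ) ^ 2 : ℝ≥0) : ℝ≥0∞) +
        ((2 / (1 + ρ) ^ 2 : ℝ≥0) : ℝ≥0∞) * tvDist (P.withDensity f) (P.withDensity g) := by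
  have hmin : Measurable fun h => min (f h) (g h) := hf.min hg
  have hmax : Measurable fun h => max (f h) (g h) := hf.max hg
  -- On this set P(B) - Q(B) equals 1 - ∫ min(f, g), which bounds the total variation distance from
  -- below.
  set B : Set H := {h | g h < f h} with hB_def
  have hB : MeasurableSet B := measurableSet_lt hg hf
  have hfB := lintegral_add_compl f hB (μ := P)
  have hmB := lintegral_add_compl (fun h => min (f h) (g h)) hB (μ := P)
  rw [setLIntegral_congr_fun hB (g := g) fun h hh => min_eq_right (le_of_lt hh),
    setLIntegral_congr_fun hB.compl (g := f) fun h hh => min_eq_left (not_lt.1 hh)] at hmB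
  have hsum : ∫⁻ h, min (f h) (g h) ∂P + ∫⁻ h, max (f h) (g h) ∂P = 2 := by
    rw [← lintegral_add_left hmin]
    simp only [min_add_max]
    rw [lintegral_add_left hf, hf1, hg1, one_add_one_eq_two]
  rw [hf1] at hfB
  set p := ∫⁻ h in B, f h ∂P with hp
  set q := ∫⁻ h in B, g h ∂P with hq
  set s := ∫⁻ h in Bᶜ, f h ∂P with hs
  set I := ∫⁻ h, min (f h) (g h) ∂P with hI
  set M := ∫⁻ h, max (f h) (g h) ∂P with hM
  have hIle : I ≤ 1 := hf1 ▸ lintegral_mono fun h => min_le_left _ _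
  have hIne : I ≠ ∞ := ne_top_of_le_ne_top ENNReal.one_ne_top hIle
  have hMne : M ≠ ∞ := fun h => by simp [h] at hsum
  have hpne : p ≠ ∞ := fun h => by simp [h] at hfB
  have hsne : s ≠ ∞ := fun h => by simp [h] at hfB
  have hqne : q ≠ ∞ := fun h => hIne (by rw [← hmB, h]; simp)
  obtain ⟨v, hv0, hv⟩ : ∃ v : ℝ, 0 ≤ v ∧ I = ENNReal.ofReal v :=
    ⟨I.toReal, ENNReal.toReal_nonneg, (ENNReal.ofReal_toReal hIne).symm⟩
  have hv1 : v ≤ 1 := by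
    rw [hv, ← ENNReal.ofReal_one] at hIle
    exact (ENNReal.ofReal_le_ofReal_iff zero_le_one).1 hIle
  have hMv : M = ENNReal.ofReal (2 - v) := by
    have h2 : M = 2 - I := by rw [← hsum, ENNReal.add_sub_cancel_left hIne]
    rw [h2, hv, ENNReal.ofReal_sub _ hv0]
    simp
  have htv : ENNReal.ofReal (1 - v) ≤ tvDist (P.withDensity f) (P.withDensity g) := by
    have h1 : ENNReal.ofReal (1 - v) = p - q := by
      have e1 := congrArg ENNReal.toReal hfB
      have e2 := congrArg ENNReal.toReal hmB
      rw [ENNReal.toReal_add hpne hsne, ENNReal.toReal_one] at e1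
      rw [ENNReal.toReal_add hqne hsne, hv, ENNReal.toReal_ofReal hv0] at e2
      have : 1 - v = p.toReal - q.toReal := by linarith
      rw [this, ENNReal.ofReal_sub _ ENNReal.toReal_nonneg, ENNReal.ofReal_toReal hpne,
        ENNReal.ofReal_toReal hqne]
    rw [h1, hp, hq, ← withDensity_apply _ hB, ← withDensity_apply _ hB]
    exact le_iSup₂_of_le (f := fun B (_ : MeasurableSet B) =>
      P.withDensity f B - P.withDensity g B) B hB le_rfl
  -- With v = ∫ min(f, g), the union of the two regions has mass 2 - v and their intersection mass
  -- v.
  have hfirst := measure_isFirstPoint hR (measurableSet_acceptRegion hmax)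
    (measurableSet_acceptRegion hmin) (u := 2 - v) (v := v)
    (by rw [← inter_acceptRegion, ← union_acceptRegion]
        exact Set.inter_subset_left.trans Set.subset_union_left) hv0 (by linarith) (by linarith)
    (by rw [prod_acceptRegion P hmax, ← hMv]) (by rw [prod_acceptRegion P hmin, ← hv])
  have hsub : {r : ℕ → H × ℝ × ℝ |
        ¬ ∃ j, IsFirstPoint (acceptRegion f) r j ∧ IsFirstPoint (acceptRegion g) r j} ⊆
      {r | ∃ j, IsFirstPoint (acceptRegion fun h => max (f h) (g h)) r j ∧
        ((r j).1, (r j).2.1) ∈ acceptRegion fun h => min (f h) (g h)}ᶜ := by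
    rintro r hr ⟨j, hj, hjm⟩
    rw [← union_acceptRegion] at hj
    rw [← inter_acceptRegion] at hjm
    exact hr ⟨j, hj.mono Set.subset_union_left hjm.1, hj.mono Set.subset_union_right hjm.2⟩
  refine (measure_mono hsub).trans ?_
  rw [prob_compl_eq_one_sub (measurableSet_exists_isFirstPoint (measurableSet_acceptRegion hmax)
    (measurableSet_acceptRegion hmin)), hfirst]
  refine le_trans ?_ (add_le_add_right (mul_le_mul_right htv _) _)
  rw [← ENNReal.ofReal_one, ← ENNReal.ofReal_sub _ (div_nonneg hv0 (by linarith)),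
    ← ENNReal.ofReal_coe_nnreal, ← ENNReal.ofReal_coe_nnreal,
    ← ENNReal.ofReal_mul (NNReal.coe_nonneg _),
    ← ENNReal.ofReal_add (NNReal.coe_nonneg _) (mul_nonneg (NNReal.coe_nonneg _) (by linarith))]
  refine ENNReal.ofReal_le_ofReal ?_
  push_cast
  have hρ : (0 : ℝ) ≤ ρ := ρ.2
  have e1 : 1 - v / (2 - v) = 2 * (1 - v) / (2 - v) := by
    have : (2 - v) ≠ 0 := by linarith
    field_simp
    ring
  have e2 : 2 * (ρ : ℝ) ^ 2 / (1 + ρ) ^ 2 + 2 / (1 + ρ) ^ 2 * (1 - v) =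
      (2 * ρ ^ 2 + 2 * (1 - v)) / (1 + ρ) ^ 2 := by ring
  rw [e1, e2, div_le_div_iff₀ (by linarith) (by positivity)]
  -- With d = 1 - v, the tangent bound clears denominators to 2dρ ≤ d² + ρ².
  nlinarith [sq_nonneg ((1 - v) - ρ)]

end RejectionSampling

/-! ### Upper expectations, absolute continuity and choice of densities -/

section Replicability

/-- Solve the affine bound for the integral of g, which needs b ≠ 0, and take the infimum over
measurable majorants g. -/
lemma le_add_mul_of_upperExpectation_le {E : Type*} [MeasurableSpace E] {μ : Measure E}
    {t : E → ℝ≥0∞} {c ρ : ℝ≥0∞} {a b : ℝ≥0} (hb : b ≠ 0) (ht : upperExpectation μ t ≤ ρ)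
    (h : ∀ g : E → ℝ≥0∞, Measurable g → (∀ x, t x ≤ g x) → c ≤ a + b * ∫⁻ x, g x ∂μ) :
    c ≤ a + b * ρ := by
  have hb' : (b : ℝ≥0∞) ≠ 0 := by simpa using hb
  have key : (c - a) / b ≤ upperExpectation μ t := by
    refine le_iInf fun g => le_iInf fun hg => le_iInf fun hgt => ?_
    rw [ENNReal.div_le_iff_le_mul (Or.inl hb') (Or.inl ENNReal.coe_ne_top), mul_comm]
    exact tsub_le_iff_left.2 (h g hg hgt)
  have := key.trans ht
  rw [ENNReal.div_le_iff_le_mul (Or.inl hb') (Or.inl ENNReal.coe_ne_top), mul_comm] at this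
  exact tsub_le_iff_left.1 this

/-- Rejection sampling accepts the same point for densities that agree almost everywhere. -/
lemma ae_isFirstAccepted {X : Type*} [MeasurableSpace (Classifier X)]
    {P : Measure (Classifier X)} [IsProbabilityMeasure P] {R : Measure (Seed X)}
    [IsProbabilityMeasure R]
    (hR : IsPoissonPointProcess (fun i (r : Seed X) => r i)
      (P.prod (lebNonneg.prod lebNonneg)) R)
    {f g : Classifier X → ℝ≥0∞} (hf : Measurable f) (hf1 : ∫⁻ h, f h ∂P = 1) (hg : Measurable g)
    (hfg : f =ᵐ[P] g) : ∀ᵐ r ∂(R), IsFirstAccepted g r (rejectionSample f r) := by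
  have hN : MeasurableSet {h | f h = g h}ᶜ := (measurableSet_eq_fun hf hg).compl
  -- The densities differ only on a P-null set of marks; the cylinder over it has intensity zero, so
  -- almost surely no point falls there.
  have hΛ : P.prod (lebNonneg.prod lebNonneg) (Prod.fst ⁻¹' {h | f h = g h}ᶜ) = 0 := by
    rw [← Set.prod_univ, Measure.prod_prod, mul_eq_zero]
    exact Or.inl hfg
  filter_upwards [ae_isFirstPoint_firstIndex hR hf hf1, hR.ae_notMem (measurable_fst hN) hΛ]
    with r hr hrN
  have heq : ∀ i, f (r i).1 = g (r i).1 := fun i => by simpa using hrN i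
  refine ⟨firstIndex (acceptRegion f) r, ?_, fun i hi hacc => hr.2 i hi ?_, rfl⟩
  · rw [← heq]
    exact hr.1
  · rw [← heq] at hacc
    exact hacc

variable {X : Type*} [MeasurableSpace X] {n : ℕ}

/-- Neither N nor {S} need be measurable, so the comparison is between outer measures: the product
one is the largest that is bounded on boxes by the product of the factors, and c ^ n times the point
mass at S satisfies that bound. -/
lemma iidLaw_ne_zero_of_mem (S : Sample X n) {D : Measure (X × Bool)} {c : ℝ≥0∞} (hc : c ≠ 0)
    (hD : ∀ i, c • Measure.dirac (S i) ≤ D) [IsProbabilityMeasure D] {N : Set (Sample X n)}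
    (hN : S ∈ N) : iidLaw n D N ≠ 0 := by
  have h : c ^ n • OuterMeasure.dirac S ≤ OuterMeasure.pi fun _ : Fin n => D.toOuterMeasure := by
    rw [OuterMeasure.le_pi]
    intro s _
    by_cases hS : S ∈ Set.univ.pi s
    · simp only [smul_apply, OuterMeasure.dirac_apply, Set.indicator_of_mem hS,
        smul_eq_mul, mul_one]
      have : ∀ i, c ≤ D (s i) := fun i => by
        have h1 := hD i (s i)
        rwa [Measure.smul_apply, Measure.dirac_apply_of_mem (hS i trivial), smul_eq_mul,
          mul_one] at h1
      calc c ^ n = ∏ _i : Fin n, c := by simp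
        _ ≤ _ := Finset.prod_le_prod' fun i _ => this i
    · simp [hS]
  intro h0
  have h1 := (h N).trans (le_toMeasure_apply _ (Measure.pi_caratheodory _) N)
  have h2 : (OuterMeasure.pi fun _ : Fin n => D.toOuterMeasure).toMeasure
    (Measure.pi_caratheodory _) = iidLaw n D := by
      rw [iidLaw, Measure.pi_def]
  rw [h2, h0] at h1
  simp [hN, hc] at h1

variable [MeasurableSpace (Classifier X)]

/-- Absolute continuity for almost all samples under every distribution means absolute continuity
for all samples, since every sample is charged by some distribution. -/
lemma IsAbsolutelyContinuousRule.absolutelyContinuous {P : Measure (Classifier X)}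
    [IsProbabilityMeasure P] {A : LearningRule X n} (hAC : IsAbsolutelyContinuousRule A P)
    (S : Sample X n) : (A S : Measure (Classifier X)) ≪ P := by
  -- For empty X there is no distribution D and the hypothesis is void, but then there is only one
  -- classifier and P charges it.
  rcases isEmpty_or_nonempty X with hX | ⟨⟨x⟩⟩
  · have : Subsingleton (Classifier X) := inferInstanceAs (Subsingleton (X → Bool))
    intro s hs
    rcases s.eq_empty_or_nonempty with rfl | hne
    · simp
    · rw [Subsingleton.eq_univ_of_nonempty hne, measure_univ] at hs
      exact absurd hs one_ne_zero
  -- D charges every entry of S; the extra atom at (x, true) makes it a probability measure even for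
  -- n = 0.
  · set D : Measure (X × Bool) :=
      (n + 1 : ℝ≥0∞)⁻¹ • (Measure.dirac (x, true) + ∑ i, Measure.dirac (S i)) with hD
    have hprob : IsProbabilityMeasure D := ⟨by
      rw [hD, Measure.smul_apply, Measure.add_apply, Measure.finsetSum_apply]
      simp only [measure_univ, Finset.sum_const, Finset.card_univ, Fintype.card_fin, smul_eq_mul,
        nsmul_eq_mul, mul_one]
      rw [add_comm]
      exact ENNReal.inv_mul_cancel (by simp) (by simp)⟩
    have hle : ∀ i, (n + 1 : ℝ≥0∞)⁻¹ • Measure.dirac (S i) ≤ D := by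
      intro i s
      simp only [hD, Measure.smul_apply, Measure.add_apply, Measure.finsetSum_apply, smul_eq_mul]
      gcongr
      exact le_add_left (Finset.single_le_sum (f := fun i => Measure.dirac (S i) s)
        (fun _ _ => zero_le) (Finset.mem_univ i))
    by_contra hS
    refine iidLaw_ne_zero_of_mem S (c := (n + 1 : ℝ≥0∞)⁻¹) (by simp) hle
      (N := {S | ¬ (A S : Measure (Classifier X)) ≪ P}) hS ?_
    exact ae_iff.1 (hAC D)

/-- One family of densities must serve all conclusions, so a jointly measurable one is chosen
whenever it exists. -/
lemma exists_density {P : Measure (Classifier X)} [IsProbabilityMeasure P] {A : LearningRule X n}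
    (hAC : IsAbsolutelyContinuousRule A P) :
    ∃ f : Sample X n → Classifier X → ℝ≥0∞, (∀ S, Measurable (f S)) ∧
      (∀ S, P.withDensity (f S) = A S) ∧
      (HasJointlyMeasurableDensity A P → Measurable fun p : Sample X n × Classifier X =>
        f p.1 p.2) := by
  by_cases h : HasJointlyMeasurableDensity A P
  · obtain ⟨f, hf, hA⟩ := h
    exact ⟨fun S h => f (S, h), fun S => hf.comp measurable_prodMk_left, fun S => (hA S).symm,
      fun _ => hf⟩
  · exact ⟨fun S => (A S : Measure (Classifier X)).rnDeriv P,
      fun S => Measure.measurable_rnDeriv _ _,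
      fun S => Measure.withDensity_rnDeriv_eq _ _ (hAC.absolutelyContinuous S),
      fun h' => absurd h' h⟩

lemma tangent_add_mul (ρ : ℝ≥0) :
    ((2 * ρ ^ 2 / (1 + ρ) ^ 2 : ℝ≥0) : ℝ≥0∞) + ((2 / (1 + ρ) ^ 2 : ℝ≥0) : ℝ≥0∞) * (ρ : ℝ≥0∞) =
      ((2 * ρ / (1 + ρ) : ℝ≥0) : ℝ≥0∞) := by
  norm_cast
  field_simp
  ring

end Replicability

end

/-! ### Coupling all samples through one Poisson cloud -/

theorem mainTheorem1 {X : Type*} [MeasurableSpace X] [MeasurableSpace (Classifier X)] {n : ℕ}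
    (P : Measure (Classifier X)) [IsProbabilityMeasure P] (A : LearningRule X n) (ρ : ℝ≥0)
    (hTV : IsTVIndistinguishable A ρ) (hAC : IsAbsolutelyContinuousRule A P) :
    ∃ R : Measure (Seed X), IsProbabilityMeasure R ∧
      IsPoissonPointProcess (fun i (r : Seed X) => r i) (P.prod (lebNonneg.prod lebNonneg)) R ∧
      ∃ A' : LearningAlgorithm X n (Seed X),
        IsEquivalentTo A' R A ∧
        (∀ S, ∀ᵐ r ∂(R),
          IsFirstAccepted ((A S : Measure (Classifier X)).rnDeriv P) r (A' S r)) ∧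
        IsReplicable A' R (2 * ρ / (1 + ρ)) ∧
        (HasJointlyMeasurableDensity A P → IsJointlyReplicable A' R (2 * ρ / (1 + ρ))) := by
  obtain ⟨μ, hμ, hsum⟩ := exists_sum_eq_prod_lebNonneg P
  obtain ⟨R, hprob, hR⟩ := exists_isPoissonPointProcess μ
  rw [hsum] at hR
  obtain ⟨f, hf, hA, hjoint⟩ := exists_density hAC
  have hf1 : ∀ S, ∫⁻ h, f S h ∂P = 1 := fun S => by
    rw [← setLIntegral_univ, ← withDensity_apply _ MeasurableSet.univ, hA, measure_univ]
  -- The line a + b d is the tangent at d = ρ to 2d/(1 + d), hence its value there is the claimed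
  -- bound.
  obtain ⟨a, b, hb0, hab, hbad⟩ : ∃ a b : ℝ≥0, b ≠ 0 ∧
      (a : ℝ≥0∞) + b * ρ = ((2 * ρ / (1 + ρ) : ℝ≥0) : ℝ≥0∞) ∧
      ∀ S S' : Sample X n, R {r | ¬ ∃ j, IsFirstPoint (acceptRegion (f S)) r j ∧
        IsFirstPoint (acceptRegion (f S')) r j} ≤
        a + b * tvDist (A S : Measure (Classifier X)) (A S') := by
    refine ⟨_, _, by positivity, tangent_add_mul ρ, fun S S' => ?_⟩
    rw [← hA, ← hA]
    exact measure_not_exists_isFirstPoint_le hR (hf S) (hf1 S) (hf S') (hf1 S') ρ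
  have hne : ∀ (S S' : Sample X n) (r : Seed X),
      rejectionSample (f S) r ≠ rejectionSample (f S') r →
      ¬ ∃ j, IsFirstPoint (acceptRegion (f S)) r j ∧ IsFirstPoint (acceptRegion (f S')) r j := by
    rintro S S' r h ⟨j, h1, h2⟩
    exact h (by rw [rejectionSample, rejectionSample, h1.firstIndex_eq, h2.firstIndex_eq])
  have hint : ∀ (D : Measure (X × Bool)) [IsProbabilityMeasure D]
      (g : Sample X n × Sample X n → ℝ≥0∞), Measurable g →
      ∫⁻ p, (a + b * g p) ∂((iidLaw n D).prod (iidLaw n D)) =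
        a + b * ∫⁻ p, g p ∂((iidLaw n D).prod (iidLaw n D)) := by
    intro D _ g hg
    rw [lintegral_add_left measurable_const, lintegral_const, measure_univ, mul_one,
      lintegral_const_mul _ hg]
  refine ⟨R, hprob, hR, fun S => rejectionSample (f S), fun S => ⟨measurable_rejectionSample (hf S),
    (map_rejectionSample hR (hf S) (hf1 S)).trans (hA S)⟩, fun S => ?_, ?_, ?_⟩
  · refine ae_isFirstAccepted hR (hf S) (hf1 S) (Measure.measurable_rnDeriv _ _) ?_
    rw [← hA S]
    exact (Measure.rnDeriv_withDensity P (hf S)).symm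
  · intro D _
    rw [← hab]
    refine le_add_mul_of_upperExpectation_le hb0 (hTV D) fun g hg hgt => ?_
    rw [← hint D g hg]
    refine iInf₂_le_of_le (fun p => a + b * g p) (by fun_prop) (iInf_le_of_le (fun p => ?_) le_rfl)
    refine ((measure_mono fun r hr => hne p.1 p.2 r hr).trans (hbad p.1 p.2)).trans ?_
    exact add_le_add_right (mul_le_mul_right (hgt p) _) _
  · intro hJ D _
    rw [← hab]
    refine le_add_mul_of_upperExpectation_le hb0 (hTV D) fun g hg hgt => ?_
    have hU : MeasurableSet {p : Sample X n × Classifier X × ℝ |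
        p.2 ∈ acceptRegion (f p.1)} := by
      have hm := hjoint hJ
      refine measurableSet_lt (ENNReal.measurable_ofReal.comp (by fun_prop)) ?_
      exact hm.comp (g := fun p : Sample X n × Classifier X => f p.1 p.2)
        (f := fun p : Sample X n × Classifier X × ℝ => (p.1, p.2.1)) (by fun_prop)
    -- The disagreement event itself may be nonmeasurable; this larger event, that no point is first
    -- for both, is measurable, so its product measure is an iterated integral.
    have hmeas : MeasurableSet {q : (Sample X n × Sample X n) × Seed X |
        ¬ ∃ j, IsFirstPoint (acceptRegion (f q.1.1)) q.2 j ∧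
          IsFirstPoint (acceptRegion (f q.1.2)) q.2 j} := by
      have hfirst := measurableSet_isFirstPoint_parametric
        (U := fun S : Sample X n => acceptRegion (f S)) hU
      have h1 : Measurable fun q : (Sample X n × Sample X n) × Seed X => (q.1.1, q.2) := by
        fun_prop
      have h2 : Measurable fun q : (Sample X n × Sample X n) × Seed X => (q.1.2, q.2) := by
        fun_prop
      have := (MeasurableSet.iUnion fun j => (h1 (hfirst j)).inter (h2 (hfirst j))).compl
      convert this using 1
      ext q
      simp
    have hsub : {q : (Sample X n × Sample X n) × Seed X |
          rejectionSample (f q.1.1) q.2 ≠ rejectionSample (f q.1.2) q.2} ⊆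
        {q | ¬ ∃ j, IsFirstPoint (acceptRegion (f q.1.1)) q.2 j ∧
          IsFirstPoint (acceptRegion (f q.1.2)) q.2 j} := fun q hq => hne q.1.1 q.1.2 q.2 hq
    refine (measure_mono hsub).trans ?_
    rw [Measure.prod_apply hmeas, ← hint D g hg]
    refine lintegral_mono fun p => (hbad p.1 p.2).trans ?_
    exact add_le_add_right (mul_le_mul_right (hgt p) _) _
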